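/- Theorem 1.2. For integers $n \ge 2$, $1 \le k \le n$ and $H \ge 1$, let $I_n(k,H)$ be the number of monic polynomials $f \in \mathbb{Z}[x]$ of degree $n$ that are irreducible in $\mathbb{Z}[x]$, have all coefficients of absolute value at most $H$, and have exactly $k$ complex roots, counted with multiplicity, whose modulus equals the largest modulus of a root of $f$. Then the following hold for every integer $n \ge 2$. (i) For every odd integer $k$ with $1 \le k \le n$: if $k \mid n$, then $$\lim_{H \to \infty} \frac{I_n(k,H)}{(2H)^{n/k}} = 1;$$ if $k \nmid n$, then $I_n(k,H) = 0$ for all integers $H \ge 1$. (ii) For every integer $k$ with $1 \le k \le n$ there is a constant $C > 0$, depending only on $n$ and $k$, such that for all integers $H \ge 1$ $$I_n(k,H) \le C\, H^{\,n-(k-1)/2}.$$ (iii) If $n$ is even, there are a constant $c > 0$ and an integer $H_0$, both depending only on $n$, such that for all integers $H \ge H_0$ $$I_n(n,H) \ge c\, H^{\frac{n}{8}+\frac{2}{n}+\frac14}.$$ -/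

import Mathlib

open Polynomial Filter Topology

/-- The height of an integer polynomial: the maximum of the absolute values of its coefficients. -/
def polyHeight (f : ℤ[X]) : ℕ :=
  f.support.sup fun i => (f.coeff i).natAbs

/-- The multiset of all complex roots of an integer polynomial, with multiplicity. -/
noncomputable def complexRoots (f : ℤ[X]) : Multiset ℂ :=
  (f.map (Int.castRingHom ℂ)).roots

/-- The house `r(f)`, the largest modulus of the complex roots of `f`
(it is `0` if there are no roots). -/
noncomputable def polyHouse (f : ℤ[X]) : NNReal :=
  ((complexRoots f).map fun z => ‖z‖₊).sup

open Classical in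
/-- The number of complex roots of `f` of maximal modulus, counted with multiplicity. -/
noncomputable def numDominantRoots (f : ℤ[X]) : ℕ :=
  ((complexRoots f).filter fun z => ‖z‖₊ = polyHouse f).card

/-- The monic integer polynomials of degree `n` and height at most `H` with exactly `k`
(not necessarily distinct) roots of maximal modulus; they are counted by `D_n(k, H)`. -/
def dominantPolys (n k H : ℕ) : Set ℤ[X] :=
  {f | f.Monic ∧ f.natDegree = n ∧ polyHeight f ≤ H ∧ numDominantRoots f = k}

/-- `I_n(k, H)`: the number of irreducible polynomials among those counted by `D_n(k, H)`. -/
noncomputable def irredCount (n k H : ℕ) : ℕ :=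
  {f ∈ dominantPolys n k H | Irreducible f}.ncard

/-- There are finitely many polynomials in `dominantPolys n k H`, so that `irredCount`
is an honest count. -/
theorem dominantPolys_finite (n k H : ℕ) : (dominantPolys n k H).Finite := by
  have hfin : (Set.pi Set.univ fun _ : Fin (n + 1) => Set.Icc (-(H : ℤ)) H).Finite :=
    Set.Finite.pi fun _ => Set.finite_Icc _ _
  refine Set.Finite.of_finite_image (f := fun (f : ℤ[X]) (i : Fin (n + 1)) => f.coeff i)
    (hfin.subset ?_) ?_
  · rintro _ ⟨f, ⟨-, -, hH, -⟩, rfl⟩ i -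
    have h : (f.coeff i).natAbs ≤ H := by
      by_cases hi : (i : ℕ) ∈ f.support
      · exact (Finset.le_sup (f := fun j => (f.coeff j).natAbs) hi).trans hH
      · simp [notMem_support_iff.mp hi]
    simp only [Set.mem_Icc]
    omega
  · rintro f ⟨-, hf, -⟩ g ⟨-, hg, -⟩ h
    ext i
    by_cases hi : i < n + 1
    · exact congrFun h ⟨i, hi⟩
    · rw [coeff_eq_zero_of_natDegree_lt (by omega), coeff_eq_zero_of_natDegree_lt (by omega)]

/-!
The house of a polynomial is the largest modulus of its roots; the roots of that modulus are called
dominant.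

*Odd `k`.* Let `f` be irreducible with an odd number `k` of dominant roots. Complex conjugation
permutes these roots, so one of them, `α`, is real, and `β * conj β = α ^ 2` for every dominant
root `β`. A Galois automorphism that maps `α` to a dominant root preserves these relations, hence
maps all dominant roots to dominant roots (`galois_mem_dominantRoots`). It fixes the product of the
dominant roots, which is `± α ^ k`; therefore all of them have the same `k`-th power
(`dominantRoots_pow_eq`), and they are the products of `α` with the `k`-th roots of unity. By
transitivity, the set of all roots is stable under the `k`-th roots of unity, so `f = g (X ^ k)`
(`numDominantRoots_dvd`). This gives `k ∣ n` and at most `(2 * H + 1) ^ (n / k)` polynomials.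
Conversely, a monic `g` of degree `m = n / k` whose coefficient of `X ^ (m - 1)` has modulus at
least `ε * H` has exactly one root of modulus larger than a bound `B` depending only on `m` and `ε`
(`card_large_roots_eq_one`). If such a `g` is reducible, it is divisible by one of the finitely many
polynomials with all roots bounded by `B`; if it is irreducible and its constant coefficient is
not a `p`-th power for any prime `p ∣ k`, then `g (X ^ k)` is irreducible by Kummer theory, and it
has `k` dominant roots. The exceptions are negligible (`le_irredCount_of_odd`).

*Upper bound for all `k`.* If the house is `r`, then `r ^ k` is at most the Mahler measure, which is
`O(H)`, and the coefficient of `X ^ (n - j)` is `O(r ^ j)`, so there are `O(H ^ min(1, j / k))`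
choices for it (`irredCount_le_rpow`).

*Lower bound for `k = n = 2 * m`.* If `g` is monic of degree `m` with all roots real and in
`[-2√q, 2√q]`, all roots of `X ^ m * g (X + q / X)` have modulus `√q`. The condition on `g` holds
when its coefficients are close to those of the rescaling by `√q` of a fixed polynomial
with `m` distinct roots in `(-2, 2)` (`exists_box_real_roots`), and congruences modulo `4` on `q` and
on the coefficients of `g` make Eisenstein's criterion apply after a shift
(`irreducible_quadLift`). The bound counts the pairs `(q, g)` with `q` of order `H ^ (1 / m)`.
-/

/-! ### Heights, roots and the house -/

theorem polyHeight_le_iff {f : ℤ[X]} {H : ℕ} :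
    polyHeight f ≤ H ↔ ∀ i, (f.coeff i).natAbs ≤ H := by
  unfold polyHeight
  rw [Finset.sup_le_iff]
  refine ⟨fun h i => ?_, fun h i _ => h i⟩
  by_cases hi : i ∈ f.support
  · exact h i hi
  · simp [notMem_support_iff.mp hi]

theorem map_ne_zero_of_monic {f : ℤ[X]} (hf : f.Monic) : f.map (Int.castRingHom ℂ) ≠ 0 :=
  (hf.map _).ne_zero

theorem mem_complexRoots {f : ℤ[X]} (hf : f.Monic) {z : ℂ} :
    z ∈ complexRoots f ↔ aeval z f = 0 := by
  rw [complexRoots, mem_roots (map_ne_zero_of_monic hf), IsRoot.def, eval_map, aeval_def]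
  rfl

theorem card_complexRoots {f : ℤ[X]} (hf : f.Monic) : (complexRoots f).card = f.natDegree := by
  rw [complexRoots, ← (IsAlgClosed.splits _).natDegree_eq_card_roots, hf.natDegree_map]

theorem nnnorm_le_polyHouse {f : ℤ[X]} {z : ℂ} (hz : z ∈ complexRoots f) :
    ‖z‖₊ ≤ polyHouse f :=
  Multiset.le_sup (Multiset.mem_map_of_mem _ hz)

theorem polyHouse_le {f : ℤ[X]} {r : NNReal} (h : ∀ z ∈ complexRoots f, ‖z‖₊ ≤ r) :
    polyHouse f ≤ r := by
  rw [polyHouse, Multiset.sup_le]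
  intro b hb
  obtain ⟨z, hz, rfl⟩ := Multiset.mem_map.mp hb
  exact h z hz

theorem polyHouse_eq {f : ℤ[X]} {r : NNReal} (h : ∀ z ∈ complexRoots f, ‖z‖₊ ≤ r)
    {z : ℂ} (hz : z ∈ complexRoots f) (hzr : ‖z‖₊ = r) : polyHouse f = r :=
  le_antisymm (polyHouse_le h) (hzr ▸ nnnorm_le_polyHouse hz)

theorem nodup_complexRoots {f : ℤ[X]} (hf : f.Monic) (hirr : Irreducible f) :
    (complexRoots f).Nodup := by
  have h := (hf.irreducible_iff_irreducible_map_fraction_map (K := ℚ)).mp hirr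
  have hsep : (f.map (Int.castRingHom ℂ)).Separable := by
    have := h.separable.map (f := algebraMap ℚ ℂ)
    rw [Polynomial.map_map] at this
    rwa [RingHom.ext_int ((algebraMap ℚ ℂ).comp (algebraMap ℤ ℚ)) (Int.castRingHom ℂ)] at this
  exact nodup_roots hsep

/-! ### Monic polynomials with prescribed lower coefficients -/

/-- The monic polynomial of degree `n` whose coefficients below the leading one are given by `a`. -/
noncomputable def monicPoly {n : ℕ} (a : Fin n → ℤ) : ℤ[X] :=
  X ^ n + ∑ i : Fin n, C (a i) * X ^ (i : ℕ)

theorem degree_monicPoly_tail_lt {n : ℕ} (a : Fin n → ℤ) :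
    (∑ i : Fin n, C (a i) * X ^ (i : ℕ)).degree < (n : WithBot ℕ) :=
  degree_sum_fin_lt a

theorem monicPoly_monic {n : ℕ} (a : Fin n → ℤ) : (monicPoly a).Monic :=
  monic_X_pow_add (degree_monicPoly_tail_lt a)

theorem natDegree_monicPoly {n : ℕ} (a : Fin n → ℤ) : (monicPoly a).natDegree = n := by
  rw [monicPoly, natDegree_add_eq_left_of_degree_lt, natDegree_X_pow]
  rw [degree_X_pow]
  exact degree_monicPoly_tail_lt a

theorem coeff_monicPoly {n : ℕ} (a : Fin n → ℤ) (i : Fin n) : (monicPoly a).coeff i = a i := by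
  have : (i : ℕ) ≠ n := i.2.ne
  simp [monicPoly, coeff_X_pow, Fin.val_inj, this]

theorem monicPoly_injective {n : ℕ} : Function.Injective (monicPoly (n := n)) := by
  intro a b h
  ext i
  rw [← coeff_monicPoly a, h, coeff_monicPoly]

theorem eq_monicPoly {n : ℕ} {f : ℤ[X]} (hf : f.Monic) (hn : f.natDegree = n) :
    f = monicPoly fun i : Fin n => f.coeff i := by
  refine ext fun i => ?_
  rcases lt_trichotomy i n with h | rfl | h
  · exact (coeff_monicPoly (fun i : Fin n => f.coeff i) ⟨i, h⟩).symm
  · have h1 := (monicPoly_monic fun j : Fin i => f.coeff j).coeff_natDegree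
    rw [natDegree_monicPoly] at h1
    rw [h1, ← hn]
    exact hf
  · rw [coeff_eq_zero_of_natDegree_lt (by omega),
      coeff_eq_zero_of_natDegree_lt (by rw [natDegree_monicPoly]; omega)]

theorem polyHeight_monicPoly_le {n H : ℕ} (hH : 1 ≤ H) {a : Fin n → ℤ}
    (ha : ∀ i, (a i).natAbs ≤ H) : polyHeight (monicPoly a) ≤ H := by
  rw [polyHeight_le_iff]
  intro i
  rcases lt_trichotomy i n with h | rfl | h
  · rw [show i = ((⟨i, h⟩ : Fin n) : ℕ) from rfl, coeff_monicPoly]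
    exact ha _
  · have h1 := (monicPoly_monic a).coeff_natDegree
    rw [natDegree_monicPoly] at h1
    simpa [h1] using hH
  · rw [coeff_eq_zero_of_natDegree_lt (by rw [natDegree_monicPoly]; omega)]
    simp

/-- A set of monic polynomials of degree `n` whose coefficients lie in given finite sets has at
most as many elements as the product of these sets. -/
theorem ncard_le_prod_of_coeff_mem {n : ℕ} {S : Set ℤ[X]} (T : Fin n → Finset ℤ)
    (hS : ∀ f ∈ S, f.Monic ∧ f.natDegree = n ∧ ∀ i : Fin n, f.coeff i ∈ T i) :
    S.ncard ≤ ∏ i, (T i).card := by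
  have hsub : S ⊆ monicPoly '' (Fintype.piFinset T : Set (Fin n → ℤ)) := by
    intro f hf
    obtain ⟨h1, h2, h3⟩ := hS f hf
    refine ⟨fun i => f.coeff i, ?_, (eq_monicPoly h1 h2).symm⟩
    simpa using h3
  have hfin : (monicPoly '' (Fintype.piFinset T : Set (Fin n → ℤ))).Finite :=
    (Finset.finite_toSet _).image _
  refine (Set.ncard_le_ncard hsub hfin).trans ((Set.ncard_image_le (Finset.finite_toSet _)).trans ?_)
  rw [Set.ncard_coe_finset, Fintype.card_piFinset]

theorem irredCount_set_finite (n k H : ℕ) :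
    {f ∈ dominantPolys n k H | Irreducible f}.Finite :=
  (dominantPolys_finite n k H).subset fun _ hf => hf.1

/-! ### The upper bound from the Mahler measure -/

/-- Each of the `k` dominant roots contributes at least its modulus to the Mahler measure. -/
theorem polyHouse_pow_numDominantRoots_le {f : ℤ[X]} (hf : f.Monic) :
    (polyHouse f : ℝ) ^ numDominantRoots f ≤ (f.map (Int.castRingHom ℂ)).mahlerMeasure := by
  classical
  rw [mahlerMeasure_eq_leadingCoeff_mul_prod_roots, (hf.map _).leadingCoeff, norm_one, one_mul,
    ← Multiset.filter_add_not (fun z : ℂ => ‖z‖₊ = polyHouse f)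
      (f.map (Int.castRingHom ℂ)).roots, Multiset.map_add, Multiset.prod_add]
  have key : ∀ s : Multiset ℂ, 1 ≤ (s.map fun a => max 1 ‖a‖).prod := by
    intro s
    induction s using Multiset.induction_on with
    | empty => simp
    | cons a s ih =>
      rw [Multiset.map_cons, Multiset.prod_cons]
      exact one_le_mul_of_one_le_of_one_le (le_max_left _ _) ih
  have key2 : ∀ s : Multiset ℂ, (∀ z ∈ s, ‖z‖₊ = polyHouse f) →
      (polyHouse f : ℝ) ^ s.card ≤ (s.map fun a => max 1 ‖a‖).prod := by
    intro s
    induction s using Multiset.induction_on with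
    | empty => simp
    | cons a s ih =>
      intro h
      rw [Multiset.map_cons, Multiset.prod_cons, Multiset.card_cons, pow_succ']
      refine mul_le_mul ?_ (ih fun z hz => h z (Multiset.mem_cons_of_mem hz)) (by positivity)
        (by positivity)
      rw [← h a (Multiset.mem_cons_self _ _), coe_nnnorm]
      exact le_max_right _ _
  refine le_trans (key2 ((complexRoots f).filter fun z => ‖z‖₊ = polyHouse f)
    fun z hz => (Multiset.mem_filter.mp hz).2) ?_
  exact le_mul_of_one_le_right (zero_le_one.trans (key _)) (key _)

theorem mahlerMeasure_le_mul_height {f : ℤ[X]} {n H : ℕ} (hn : f.natDegree = n)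
    (hH : polyHeight f ≤ H) :
    (f.map (Int.castRingHom ℂ)).mahlerMeasure ≤ (n + 1) * H := by
  refine (mahlerMeasure_le_sum_norm_coeff _).trans ?_
  rw [sum_def]
  have h1 : ∀ i ∈ (f.map (Int.castRingHom ℂ)).support,
      ‖(f.map (Int.castRingHom ℂ)).coeff i‖ ≤ H := by
    intro i _
    have := polyHeight_le_iff.mp hH i
    rw [coeff_map, eq_intCast, Complex.norm_intCast, ← Int.cast_abs, Int.abs_eq_natAbs]
    exact_mod_cast this
  refine (Finset.sum_le_card_nsmul _ _ _ h1).trans ?_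
  rw [nsmul_eq_mul]
  gcongr
  have h2 := card_supp_le_succ_natDegree (f.map (Int.castRingHom ℂ))
  have h3 := natDegree_map_le (f := Int.castRingHom ℂ) (p := f)
  exact_mod_cast (by omega : (f.map (Int.castRingHom ℂ)).support.card ≤ n + 1)

theorem sum_min_one_div {n k : ℕ} (hk : 1 ≤ k) (hkn : k ≤ n) :
    ∑ i : Fin n, min (1 : ℝ) (((n - i : ℕ) : ℝ) / k) = n - ((k : ℝ) - 1) / 2 := by
  have hk0 : (k : ℝ) ≠ 0 := by positivity
  rw [Fin.sum_univ_eq_sum_range (fun i => min (1 : ℝ) (((n - i : ℕ) : ℝ) / k)),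
    ← Finset.sum_range_reflect]
  have h1 : ∀ N, N ≤ k → ∑ j ∈ Finset.range N, min (1 : ℝ) (((j + 1 : ℕ) : ℝ) / k)
      = N * (N + 1) / (2 * k) := by
    intro N
    induction N with
    | zero => simp
    | succ N ih =>
      intro h
      rw [Finset.sum_range_succ, ih (by omega), min_eq_right]
      · push_cast; field_simp; ring
      · rw [div_le_one (by positivity)]; exact_mod_cast h
  have h2 : ∀ N, k ≤ N → ∑ j ∈ Finset.range N, min (1 : ℝ) (((j + 1 : ℕ) : ℝ) / k)
      = N - ((k : ℝ) - 1) / 2 := by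
    intro N hN
    induction N, hN using Nat.le_induction with
    | base => rw [h1 k le_rfl]; field_simp; ring
    | succ N hN ih =>
      rw [Finset.sum_range_succ, ih, min_eq_left]
      · push_cast; ring
      · rw [le_div_iff₀ (by positivity), one_mul]; exact_mod_cast (by omega : k ≤ N + 1)
  rw [← h2 n hkn]
  refine Finset.sum_congr rfl fun j hj => ?_
  have := Finset.mem_range.mp hj
  rw [show n - (n - 1 - j) = j + 1 by omega]

theorem card_Icc_floor_le {B : ℝ} (hB : 1 ≤ B) :
    ((Finset.Icc (-⌊B⌋) ⌊B⌋).card : ℝ) ≤ 3 * B := by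
  have h0 : (0 : ℤ) ≤ ⌊B⌋ := Int.floor_nonneg.mpr (by linarith)
  have h : ((Finset.Icc (-⌊B⌋) ⌊B⌋).card : ℤ) = 2 * ⌊B⌋ + 1 := by
    rw [Int.card_Icc, Int.toNat_of_nonneg (by omega)]; ring
  have h2 : ((Finset.Icc (-⌊B⌋) ⌊B⌋).card : ℝ) = 2 * ⌊B⌋ + 1 := by exact_mod_cast h
  rw [h2]
  linarith [Int.floor_le B]

theorem norm_coeff_le_of_mem_dominantPolys {n k H : ℕ} (hk : 1 ≤ k) (hH : 1 ≤ H)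
    {f : ℤ[X]} (hf : f ∈ dominantPolys n k H) {i : ℕ} :
    |(f.coeff i : ℝ)| ≤
      2 ^ n * (n + 1) ^ n * (H : ℝ) ^ min (1 : ℝ) (((n - i : ℕ) : ℝ) / k) := by
  obtain ⟨hm, hn, hh, hkk⟩ := hf
  have hH1 : (1 : ℝ) ≤ H := by exact_mod_cast hH
  have hA : (1 : ℝ) ≤ (n : ℝ) + 1 := by linarith [(Nat.cast_nonneg n : (0 : ℝ) ≤ n)]
  have hcoe : |(f.coeff i : ℝ)| ≤ H := by
    have := polyHeight_le_iff.mp hh i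
    rw [← Int.cast_abs, Int.abs_eq_natAbs]
    exact_mod_cast this
  rcases min_cases (1 : ℝ) (((n - i : ℕ) : ℝ) / k) with ⟨h, -⟩ | ⟨h, -⟩
  · rw [h, Real.rpow_one]
    refine hcoe.trans (le_mul_of_one_le_left (by positivity) ?_)
    exact one_le_mul_of_one_le_of_one_le (one_le_pow₀ (by norm_num)) (one_le_pow₀ hA)
  · rw [h]
    have hr : (polyHouse f : ℝ) ^ k ≤ (n + 1) * H := by
      have := polyHouse_pow_numDominantRoots_le hm
      rw [hkk] at this
      exact this.trans (mahlerMeasure_le_mul_height hn hh)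
    have hk0 : (k : ℝ) ≠ 0 := by positivity
    have hr' : (polyHouse f : ℝ) ^ (n - i) ≤ ((n + 1) * H : ℝ) ^ (((n - i : ℕ) : ℝ) / k) := by
      have h1 := Real.rpow_le_rpow (by positivity) hr
        (show (0 : ℝ) ≤ ((n - i : ℕ) : ℝ) / k by positivity)
      rwa [← Real.rpow_natCast, ← Real.rpow_mul (by positivity), mul_div_cancel₀ _ hk0,
        Real.rpow_natCast] at h1
    have hc := coeff_le_of_roots_le (f := Int.castRingHom ℂ) (p := f)
      (B := polyHouse f) i hm (IsAlgClosed.splits _)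
      (fun z hz => by exact_mod_cast nnnorm_le_polyHouse (f := f) hz)
    rw [coeff_map, eq_intCast, Complex.norm_intCast, hn] at hc
    refine hc.trans ?_
    rw [Real.mul_rpow (by positivity) (by positivity)] at hr'
    have h3 : ((n : ℝ) + 1) ^ (((n - i : ℕ) : ℝ) / k) ≤ (n + 1) ^ n := by
      rw [← Real.rpow_natCast _ n]
      refine Real.rpow_le_rpow_of_exponent_le hA ?_
      have : ((n - i : ℕ) : ℝ) ≤ n := by exact_mod_cast Nat.sub_le n i
      exact (div_le_self (by positivity) (by exact_mod_cast hk)).trans this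
    have h4 : (n.choose i : ℝ) ≤ 2 ^ n := by exact_mod_cast Nat.choose_le_two_pow n i
    calc (polyHouse f : ℝ) ^ (n - i) * n.choose i
        ≤ ((n + 1) ^ n * (H : ℝ) ^ (((n - i : ℕ) : ℝ) / k)) * 2 ^ n := by
          gcongr
          exact hr'.trans (by gcongr)
      _ = _ := by ring

/-- With `k` roots of maximal modulus `r`, the Mahler measure gives `r ^ k ≪ H`, so that the
coefficient of `X ^ (n - j)` is `≪ r ^ j ≪ H ^ (j / k)`. -/
theorem irredCount_le_rpow {n k : ℕ} (hk : 1 ≤ k) (hkn : k ≤ n) :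
    ∃ C : ℝ, 0 < C ∧ ∀ H : ℕ, 1 ≤ H →
      (irredCount n k H : ℝ) ≤ C * (H : ℝ) ^ ((n : ℝ) - ((k : ℝ) - 1) / 2) := by
  refine ⟨(3 * (2 ^ n * (n + 1) ^ n)) ^ n, by positivity, fun H hH => ?_⟩
  have hH1 : (1 : ℝ) ≤ H := by exact_mod_cast hH
  have hA : (1 : ℝ) ≤ (n : ℝ) + 1 := by linarith [(Nat.cast_nonneg n : (0 : ℝ) ≤ n)]
  set K : ℝ := 2 ^ n * (n + 1) ^ n with hK
  have hK1 : 1 ≤ K :=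
    one_le_mul_of_one_le_of_one_le (one_le_pow₀ (by norm_num)) (one_le_pow₀ hA)
  set e : Fin n → ℝ := fun i => min (1 : ℝ) (((n - i : ℕ) : ℝ) / k) with he
  set B : Fin n → ℝ := fun i => K * (H : ℝ) ^ e i with hB
  have he0 : ∀ i, 0 ≤ e i := fun i => le_min zero_le_one (by positivity)
  have hB1 : ∀ i, 1 ≤ B i := fun i =>
    one_le_mul_of_one_le_of_one_le hK1 (Real.one_le_rpow hH1 (he0 i))
  have hcount : irredCount n k H ≤ ∏ i, (Finset.Icc (-⌊B i⌋) ⌊B i⌋).card := by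
    refine ncard_le_prod_of_coeff_mem _ ?_
    rintro f ⟨hf, -⟩
    refine ⟨hf.1, hf.2.1, fun i => ?_⟩
    have := norm_coeff_le_of_mem_dominantPolys (i := i) hk hH hf
    rw [abs_le] at this
    rw [Finset.mem_Icc, neg_le, Int.le_floor, Int.le_floor]
    push_cast
    exact ⟨by linarith [this.1], this.2⟩
  calc (irredCount n k H : ℝ) ≤ ∏ i, ((Finset.Icc (-⌊B i⌋) ⌊B i⌋).card : ℝ) := by
        exact_mod_cast hcount
    _ ≤ ∏ i, (3 * K * (H : ℝ) ^ e i) := by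
        refine Finset.prod_le_prod (fun _ _ => by positivity) fun i _ => ?_
        rw [mul_assoc]
        exact card_Icc_floor_le (hB1 i)
    _ = (3 * K) ^ n * (H : ℝ) ^ ((n : ℝ) - ((k : ℝ) - 1) / 2) := by
        rw [Finset.prod_mul_distrib, Finset.prod_const, Finset.card_univ, Fintype.card_fin,
          ← Real.rpow_sum_of_pos (by positivity), sum_min_one_div hk hkn]

/-! ### Rotational symmetry forced by a real dominant root -/

open Classical in
/-- The dominant roots of `f`, as elements of the field of algebraic numbers. -/
noncomputable def dominantRoots (f : ℤ[X]) : Finset (algebraicClosure ℚ ℂ) :=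
  (f.map (Int.castRingHom (algebraicClosure ℚ ℂ))).roots.toFinset.filter
    fun x => ‖(x : ℂ)‖₊ = polyHouse f

theorem mem_dominantRoots {f : ℤ[X]} (hf : f.Monic) {x : algebraicClosure ℚ ℂ} :
    x ∈ dominantRoots f ↔ aeval x f = 0 ∧ ‖(x : ℂ)‖₊ = polyHouse f := by
  classical
  rw [dominantRoots, Finset.mem_filter, Multiset.mem_toFinset, mem_roots (hf.map _).ne_zero,
    IsRoot.def, eval_map, aeval_def]
  rfl

theorem aeval_coe_eq_zero_iff {f : ℤ[X]} {x : algebraicClosure ℚ ℂ} :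
    aeval (x : ℂ) f = 0 ↔ aeval x f = 0 := by
  have : aeval (x : ℂ) f = ((aeval x f : algebraicClosure ℚ ℂ) : ℂ) :=
    aeval_algebraMap_apply ℂ x f
  rw [this, ZeroMemClass.coe_eq_zero]

theorem mem_algebraicClosure_of_aeval_eq_zero {f : ℤ[X]} (hf : f.Monic) {z : ℂ}
    (hz : aeval z f = 0) : z ∈ algebraicClosure ℚ ℂ := by
  rw [mem_algebraicClosure_iff]
  refine ⟨f.map (algebraMap ℤ ℚ), (hf.map _).ne_zero, ?_⟩
  rwa [aeval_map_algebraMap]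

theorem card_dominantRoots {f : ℤ[X]} (hf : f.Monic) (hirr : Irreducible f) :
    (dominantRoots f).card = numDominantRoots f := by
  classical
  rw [numDominantRoots, Finset.card_def, ← Multiset.card_map ((↑) : algebraicClosure ℚ ℂ → ℂ)]
  congr 1
  refine (Multiset.Nodup.ext ((Finset.nodup _).map Subtype.coe_injective)
    ((nodup_complexRoots hf hirr).filter _)).mpr fun z => ?_
  rw [Multiset.mem_map, Multiset.mem_filter, mem_complexRoots hf]
  constructor
  · rintro ⟨x, hx, rfl⟩
    obtain ⟨h1, h2⟩ := (mem_dominantRoots hf).mp hx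
    exact ⟨aeval_coe_eq_zero_iff.mpr h1, h2⟩
  · rintro ⟨h1, h2⟩
    exact ⟨⟨z, mem_algebraicClosure_of_aeval_eq_zero hf h1⟩,
      (mem_dominantRoots hf).mpr ⟨aeval_coe_eq_zero_iff.mp h1, h2⟩, rfl⟩

theorem aeval_conj_eq_zero {f : ℤ[X]} {z : ℂ} (hz : aeval z f = 0) :
    aeval (starRingEnd ℂ z) f = 0 := by
  have h := congrArg (starRingEnd ℂ) hz
  rw [map_zero, aeval_def, hom_eval₂] at h
  rwa [aeval_def, RingHom.ext_int (algebraMap ℤ ℂ) ((starRingEnd ℂ).comp (algebraMap ℤ ℂ))]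

theorem exists_conj_mem_dominantRoots {f : ℤ[X]} (hf : f.Monic) {x : algebraicClosure ℚ ℂ}
    (hx : x ∈ dominantRoots f) :
    ∃ y ∈ dominantRoots f, (y : ℂ) = starRingEnd ℂ x := by
  obtain ⟨h1, h2⟩ := (mem_dominantRoots hf).mp hx
  have h3 := aeval_conj_eq_zero (aeval_coe_eq_zero_iff.mpr h1)
  refine ⟨⟨_, mem_algebraicClosure_of_aeval_eq_zero hf h3⟩,
    (mem_dominantRoots hf).mpr ⟨aeval_coe_eq_zero_iff.mp h3, ?_⟩, rfl⟩
  rw [← h2]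
  exact RCLike.nnnorm_conj _

theorem exists_real_mem_dominantRoots {f : ℤ[X]} (hf : f.Monic)
    (hodd : Odd (dominantRoots f).card) :
    ∃ x ∈ dominantRoots f, starRingEnd ℂ x = x := by
  by_contra! hne
  choose! c hc hcx using fun x hx => exists_conj_mem_dominantRoots hf (x := x) hx
  -- Without a fixed point, conjugation would pair off the dominant roots.
  have h : ∑ x ∈ dominantRoots f, (1 : ZMod 2) = 0 := by
    refine Finset.sum_involution (fun x _ => c x) (fun _ _ => by decide) (fun x hx _ h => ?_)
      (fun x hx => hc x hx) fun x hx => ?_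
    · exact hne x hx (by rw [← hcx x hx, h])
    · apply Subtype.ext
      rw [hcx _ (hc x hx), hcx x hx, Complex.conj_conj]
  rw [Finset.sum_const, nsmul_eq_mul, mul_one, ZMod.natCast_eq_zero_iff] at h
  exact (Nat.not_even_iff_odd.mpr hodd) (even_iff_two_dvd.mpr h)

theorem exists_galois_conj {f : ℤ[X]} (hf : f.Monic) (hirr : Irreducible f)
    {x y : algebraicClosure ℚ ℂ} (hx : aeval x f = 0) (hy : aeval y f = 0) :
    ∃ σ : Gal(algebraicClosure ℚ ℂ/ℚ), σ x = y := by
  have hirr' := (hf.irreducible_iff_irreducible_map_fraction_map (K := ℚ)).mp hirr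
  have hx' : aeval x (f.map (algebraMap ℤ ℚ)) = 0 := by rwa [aeval_map_algebraMap]
  have hy' : aeval y (f.map (algebraMap ℤ ℚ)) = 0 := by rwa [aeval_map_algebraMap]
  have halg : Algebra.IsAlgebraic ℚ (algebraicClosure ℚ ℂ) := algebraicClosure.isAlgebraic ℚ ℂ
  have hclosure : IsAlgClosure ℚ (algebraicClosure ℚ ℂ) := algebraicClosure.isAlgClosure ℚ ℂ
  refine minpoly.exists_algEquiv_of_root' (Algebra.IsAlgebraic.isAlgebraic x) ?_
  rwa [← minpoly.eq_of_irreducible_of_monic hirr' hx' (hf.map _)]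

theorem aeval_galois {f : ℤ[X]} (σ : Gal(algebraicClosure ℚ ℂ/ℚ)) {x : algebraicClosure ℚ ℂ}
    (hx : aeval x f = 0) : aeval (σ x) f = 0 := by
  have := aeval_algHom_apply ((σ : algebraicClosure ℚ ℂ →ₐ[ℚ] algebraicClosure ℚ ℂ).restrictScalars ℤ)
    x f
  rw [hx, map_zero] at this
  exact this

/-- If a Galois automorphism sends a real dominant root `α` to a dominant root, it permutes the
dominant roots: for such a root `β`, the relation `β * conj β = α ^ 2` is mapped to
`σ β * σ (conj β) = (σ α) ^ 2`, and neither factor on the left exceeds the house. -/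
theorem galois_mem_dominantRoots {f : ℤ[X]} (hf : f.Monic) {α β : algebraicClosure ℚ ℂ}
    (hα : α ∈ dominantRoots f) (hreal : starRingEnd ℂ α = α)
    {σ : Gal(algebraicClosure ℚ ℂ/ℚ)} (hσ : σ α ∈ dominantRoots f)
    (hβ : β ∈ dominantRoots f) (hpos : 0 < polyHouse f) : σ β ∈ dominantRoots f := by
  obtain ⟨β', hβ', hconj⟩ := exists_conj_mem_dominantRoots hf hβ
  have hmul : β * β' = α * α := by
    apply Subtype.ext
    have h1 : (α : ℂ) * α = α * starRingEnd ℂ α := by rw [hreal]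
    change (β : ℂ) * β' = (α : ℂ) * α
    rw [h1, hconj, Complex.mul_conj, Complex.mul_conj, Complex.normSq_eq_norm_sq,
      Complex.normSq_eq_norm_sq, ← coe_nnnorm, ← coe_nnnorm,
      ((mem_dominantRoots hf).mp hα).2, ((mem_dominantRoots hf).mp hβ).2]
  have hle : ∀ x ∈ dominantRoots f, ‖((σ x : algebraicClosure ℚ ℂ) : ℂ)‖₊ ≤ polyHouse f := by
    intro x hx
    refine nnnorm_le_polyHouse ((mem_complexRoots hf).mpr (aeval_coe_eq_zero_iff.mpr ?_))
    exact aeval_galois σ ((mem_dominantRoots hf).mp hx).1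
  refine (mem_dominantRoots hf).mpr
    ⟨aeval_galois σ ((mem_dominantRoots hf).mp hβ).1, le_antisymm (hle β hβ) ?_⟩
  have h2 : ((σ β : algebraicClosure ℚ ℂ) : ℂ) * (σ β' : algebraicClosure ℚ ℂ)
      = (σ α : algebraicClosure ℚ ℂ) * (σ α : algebraicClosure ℚ ℂ) := by
    have := congrArg (fun x => ((σ x : algebraicClosure ℚ ℂ) : ℂ)) hmul
    simpa using this
  have h3 := congrArg nnnorm h2
  rw [nnnorm_mul, nnnorm_mul, ((mem_dominantRoots hf).mp hσ).2] at h3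
  refine le_of_mul_le_mul_right ?_ hpos
  rw [← h3]
  gcongr
  exact hle β' hβ'

theorem coeff_zero_ne_zero {f : ℤ[X]} (hf : f.Monic) (hirr : Irreducible f)
    (hn : 2 ≤ f.natDegree) : f.coeff 0 ≠ 0 := by
  intro h0
  obtain ⟨g, rfl⟩ := X_dvd_iff.mpr h0
  have hg : g.Monic := monic_X.of_mul_monic_left hf
  rcases hirr.isUnit_or_isUnit rfl with h | h
  · exact not_isUnit_X h
  · rw [hg.isUnit_iff.mp h, mul_one, natDegree_X] at hn
    omega

theorem polyHouse_pos {f : ℤ[X]} (hf : f.Monic) (hirr : Irreducible f) (hn : 2 ≤ f.natDegree) :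
    0 < polyHouse f := by
  have h0 := coeff_zero_ne_zero hf hirr hn
  obtain ⟨z, hz⟩ : ∃ z, z ∈ complexRoots f := by
    rw [← Multiset.card_pos_iff_exists_mem, card_complexRoots hf]
    omega
  refine lt_of_lt_of_le (nnnorm_pos.mpr ?_) (nnnorm_le_polyHouse hz)
  rintro rfl
  rw [mem_complexRoots hf, ← coeff_zero_eq_aeval_zero'] at hz
  exact h0 (by simpa using hz)

/-- All dominant roots of `f` have the same `k`-th power, where `k` is their number: up to sign,
that power is the product of all dominant roots. -/
theorem dominantRoots_pow_eq {f : ℤ[X]} (hf : f.Monic) (hirr : Irreducible f)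
    (hn : 2 ≤ f.natDegree) {α γ : algebraicClosure ℚ ℂ}
    (hα : α ∈ dominantRoots f) (hreal : starRingEnd ℂ α = α) (hγ : γ ∈ dominantRoots f) :
    γ ^ (dominantRoots f).card = α ^ (dominantRoots f).card := by
  classical
  set S := dominantRoots f with hS
  have hconjprod : starRingEnd ℂ ((∏ x ∈ S, x : algebraicClosure ℚ ℂ) : ℂ)
      = ((∏ x ∈ S, x : algebraicClosure ℚ ℂ) : ℂ) := by
    choose! c hc hcx using fun x hx => exists_conj_mem_dominantRoots hf (x := x) hx
    have hcc : ∀ x ∈ S, c (c x) = x := fun x hx => by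
      apply Subtype.ext
      rw [hcx _ (hc x hx), hcx x hx, Complex.conj_conj]
    push_cast
    rw [map_prod]
    refine Finset.prod_bij' (fun x _ => c x) (fun x _ => c x) hc hc hcc hcc fun x hx => ?_
    exact (hcx x hx).symm
  have hsq : (∏ x ∈ S, x) ^ 2 = (α ^ S.card) ^ 2 := by
    apply Subtype.ext
    have hnorm : ∀ x ∈ S, (x : ℂ) * starRingEnd ℂ x = (α : ℂ) ^ 2 := by
      intro x hx
      have h1 : (α : ℂ) ^ 2 = α * starRingEnd ℂ α := by rw [hreal, sq]
      rw [h1, Complex.mul_conj, Complex.mul_conj, Complex.normSq_eq_norm_sq,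
        Complex.normSq_eq_norm_sq, ← coe_nnnorm, ← coe_nnnorm,
        ((mem_dominantRoots hf).mp hα).2, ((mem_dominantRoots hf).mp hx).2]
    have h2 : ((∏ x ∈ S, x : algebraicClosure ℚ ℂ) : ℂ) ^ 2
        = ∏ x ∈ S, ((x : ℂ) * starRingEnd ℂ x) := by
      rw [sq]
      nth_rewrite 2 [← hconjprod]
      push_cast
      rw [map_prod, Finset.prod_mul_distrib]
    change ((∏ x ∈ S, x : algebraicClosure ℚ ℂ) : ℂ) ^ 2 = ((α : ℂ) ^ S.card) ^ 2
    rw [h2, Finset.prod_congr rfl hnorm, Finset.prod_const, ← pow_mul, ← pow_mul, mul_comm]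
  obtain ⟨σ, hσ⟩ := exists_galois_conj hf hirr ((mem_dominantRoots hf).mp hα).1
    ((mem_dominantRoots hf).mp hγ).1
  have himage : S.image σ = S := by
    refine Finset.eq_of_subset_of_card_le ?_ (Finset.card_image_of_injective _ σ.injective).ge
    intro y hy
    obtain ⟨x, hx, rfl⟩ := Finset.mem_image.mp hy
    exact galois_mem_dominantRoots hf hα hreal (hσ ▸ hγ) hx (polyHouse_pos hf hirr hn)
  have hfix : σ (∏ x ∈ S, x) = ∏ x ∈ S, x := by
    rw [map_prod]
    conv_rhs => rw [← himage]
    rw [Finset.prod_image fun x _ y _ h => σ.injective h]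
  rcases sq_eq_sq_iff_eq_or_eq_neg.mp hsq with h | h
  · rw [h, map_pow, hσ] at hfix
    exact hfix
  · rw [h, map_neg, map_pow, hσ] at hfix
    exact neg_injective hfix

/-- The roots of `f` are stable under multiplication by `k`-th roots of unity. -/
theorem aeval_mul_rootOfUnity {f : ℤ[X]} (hf : f.Monic) (hirr : Irreducible f)
    (hn : 2 ≤ f.natDegree) (hodd : Odd (numDominantRoots f)) {z ζ : ℂ} (hz : aeval z f = 0)
    (hζ : ζ ^ numDominantRoots f = 1) : aeval (ζ * z) f = 0 := by
  classical
  rw [← card_dominantRoots hf hirr] at hodd hζ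
  set k := (dominantRoots f).card with hk
  have hk0 : 0 < k := hodd.pos
  obtain ⟨α, hα, hreal⟩ := exists_real_mem_dominantRoots hf hodd
  -- Both sets have `k` elements, so all `α * η` with `η ^ k = 1` are dominant roots.
  have hS : dominantRoots f = (nthRoots k (α ^ k)).toFinset := by
    refine Finset.eq_of_subset_of_card_le (fun γ hγ => ?_)
      ((Multiset.toFinset_card_le _).trans (card_nthRoots _ _))
    rw [Multiset.mem_toFinset, mem_nthRoots hk0]
    exact dominantRoots_pow_eq hf hirr hn hα hreal hγ
  have hζmem : ζ ∈ algebraicClosure ℚ ℂ := by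
    rw [mem_algebraicClosure_iff]
    refine ⟨X ^ k - 1, (monic_X_pow_sub_C (1 : ℚ) hk0.ne').ne_zero, by simp [hζ]⟩
  lift z to algebraicClosure ℚ ℂ using mem_algebraicClosure_of_aeval_eq_zero hf hz
  lift ζ to algebraicClosure ℚ ℂ using hζmem
  rw [aeval_coe_eq_zero_iff] at hz
  have hζ' : ζ ^ k = 1 := Subtype.ext hζ
  obtain ⟨σ, hσ⟩ := exists_galois_conj hf hirr ((mem_dominantRoots hf).mp hα).1 hz
  have h1 : σ.symm ζ * α ∈ dominantRoots f := by
    rw [hS, Multiset.mem_toFinset, mem_nthRoots hk0, mul_pow, ← map_pow, hζ', map_one, one_mul]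
  have h2 := aeval_galois σ ((mem_dominantRoots hf).mp h1).1
  rw [map_mul, AlgEquiv.apply_symm_apply, hσ] at h2
  exact aeval_coe_eq_zero_iff.mpr h2

/-- An irreducible polynomial of degree at least `2` with an odd number `k` of dominant roots is a
polynomial in `X ^ k`. -/
theorem numDominantRoots_dvd {f : ℤ[X]} (hf : f.Monic) (hirr : Irreducible f)
    (hn : 2 ≤ f.natDegree) (hodd : Odd (numDominantRoots f)) :
    numDominantRoots f ∣ f.natDegree ∧ ∀ i, f.coeff i ≠ 0 → numDominantRoots f ∣ i := by
  set k := numDominantRoots f with hk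
  have hk0 : k ≠ 0 := hodd.pos.ne'
  set ζ := Complex.exp (2 * Real.pi * Complex.I / k)
  have hζ : IsPrimitiveRoot ζ k := Complex.isPrimitiveRoot_exp k hk0
  set F := f.map (Int.castRingHom ℂ) with hF
  have hFm : F.Monic := hf.map _
  have hζ0 : ζ ≠ 0 := Complex.exp_ne_zero _
  have hdeg : (F.comp (C ζ * X)).natDegree = F.natDegree := by
    rw [natDegree_comp, natDegree_C_mul_X _ hζ0, mul_one]
  have hne : F.comp (C ζ * X) ≠ 0 := by
    intro h
    rw [h, natDegree_zero, hF, hf.natDegree_map] at hdeg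
    omega
  have hdvd : F ∣ F.comp (C ζ * X) := by
    refine (IsAlgClosed.splits F).dvd_of_roots_le_roots hFm.ne_zero ?_
    refine (Multiset.le_iff_subset (nodup_complexRoots hf hirr)).mpr fun z hz => ?_
    have h1 := aeval_mul_rootOfUnity hf hirr hn hodd ((mem_complexRoots hf).mp hz) hζ.pow_eq_one
    rw [mem_roots hne, IsRoot.def, eval_comp, eval_mul, eval_C, eval_X, hF, eval_map]
    exact h1
  have heq := eq_leadingCoeff_mul_of_monic_of_dvd_of_natDegree_le hFm hdvd hdeg.le
  set c := (F.comp (C ζ * X)).leadingCoeff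
  have hcoeff : ∀ i, (f.coeff i : ℂ) * ζ ^ i = c * f.coeff i := by
    intro i
    have := congrArg (fun p => p.coeff i) heq
    simpa [comp_C_mul_X_coeff, hF] using this
  have h0 := coeff_zero_ne_zero hf hirr hn
  -- Comparing constant coefficients gives `c = 1`, then the others give `ζ ^ i = 1`.
  have hc : c = 1 := by
    have h1 := hcoeff 0
    have h0' : (f.coeff 0 : ℂ) ≠ 0 := by exact_mod_cast h0
    rw [pow_zero, mul_comm] at h1
    exact (mul_right_cancel₀ h0' h1).symm
  have hall : ∀ i, f.coeff i ≠ 0 → k ∣ i := by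
    intro i hi
    have h1 := hcoeff i
    have hi' : (f.coeff i : ℂ) ≠ 0 := by exact_mod_cast hi
    rw [hc, mul_comm] at h1
    exact hζ.dvd_of_pow_eq_one _ (mul_right_cancel₀ hi' h1)
  exact ⟨hall _ (by rw [hf.coeff_natDegree]; exact one_ne_zero), hall⟩

/-! ### Counting polynomials in `X ^ k` -/

/-- For odd `k`, the polynomials counted by `irredCount n k H` are of the form `g (X ^ k)`, with
`g` monic of degree `n / k`. -/
theorem irredCount_le_pow_of_odd {m k H : ℕ} (hodd : Odd k) (hn : 2 ≤ m * k) :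
    irredCount (m * k) k H ≤ (2 * H + 1) ^ m := by
  have hk0 : 0 < k := hodd.pos
  set T : Fin m → Finset ℤ := fun _ => Finset.Icc (-(H : ℤ)) H with hT
  have hsub : {f ∈ dominantPolys (m * k) k H | Irreducible f} ⊆
      (fun a => expand ℤ k (monicPoly a)) '' (Fintype.piFinset T : Set (Fin m → ℤ)) := by
    rintro f ⟨⟨hf, hdeg, hH, hkf⟩, hirr⟩
    have h1 := (numDominantRoots_dvd hf hirr (hdeg ▸ hn) (hkf ▸ hodd)).2
    rw [hkf] at h1
    have hexp : expand ℤ k (contract k f) = f := by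
      ext i
      rw [coeff_expand hk0]
      split_ifs with h
      · rw [coeff_contract hk0.ne', Nat.div_mul_cancel h]
      · by_contra hi
        exact h (h1 i (Ne.symm hi))
    have hm : (contract k f).Monic := by
      rw [← monic_expand_iff hk0, hexp]; exact hf
    have hd : (contract k f).natDegree = m := by
      have := natDegree_expand k (contract k f)
      rw [hexp, hdeg] at this
      exact (Nat.eq_of_mul_eq_mul_right hk0 this).symm
    refine ⟨fun i : Fin m => (contract k f).coeff i, ?_, ?_⟩
    · simp only [hT, Finset.mem_coe, Fintype.mem_piFinset, Finset.mem_Icc]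
      intro i
      rw [coeff_contract hk0.ne']
      have := polyHeight_le_iff.mp hH (i * k)
      omega
    · change expand ℤ k _ = f
      rw [← eq_monicPoly hm hd, hexp]
  refine (Set.ncard_le_ncard hsub ((Finset.finite_toSet _).image _)).trans
    ((Set.ncard_image_le (Finset.finite_toSet _)).trans ?_)
  rw [Set.ncard_coe_finset, Fintype.card_piFinset]
  simp only [hT, Int.card_Icc, Finset.prod_const, Finset.card_univ, Fintype.card_fin]
  exact (congrArg (· ^ m) (by omega)).le

/-! ### Polynomials with a single large root -/

/-- A root of large modulus is close to the negative of the second highest coefficient. -/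
theorem norm_add_nextCoeff_le {m : ℕ} {g : ℤ[X]} (hg : g.Monic) (hdeg : g.natDegree = m + 1)
    {H B : ℝ} (hH : ∀ i, |(g.coeff i : ℝ)| ≤ H) (hB : 2 ≤ B) {z : ℂ} (hz : aeval z g = 0)
    (hzB : B < ‖z‖) : ‖z + g.coeff m‖ ≤ 2 * H / B := by
  have hH0 : 0 ≤ H := (abs_nonneg _).trans (hH 0)
  have hlead : g.coeff (m + 1) = 1 := by rw [← hdeg]; exact hg
  rw [aeval_eq_sum_range, hdeg, Finset.sum_range_succ, Finset.sum_range_succ, hlead, one_smul] at hz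
  have h1 : z ^ m * (z + g.coeff m) = -∑ i ∈ Finset.range m, g.coeff i • z ^ i := by
    rw [eq_neg_iff_add_eq_zero, ← hz, zsmul_eq_mul]; ring
  have h2 : ‖z‖ ^ m * ‖z + g.coeff m‖ ≤ H * ∑ i ∈ Finset.range m, ‖z‖ ^ i := by
    rw [← norm_pow, ← norm_mul, h1, norm_neg, Finset.mul_sum]
    refine (norm_sum_le _ _).trans (Finset.sum_le_sum fun i _ => ?_)
    rw [zsmul_eq_mul, norm_mul, norm_pow, Complex.norm_intCast]
    gcongr
    exact hH i
  have h3 : (∑ i ∈ Finset.range m, ‖z‖ ^ i) * (‖z‖ - 1) ≤ ‖z‖ ^ m := by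
    rw [geom_sum_mul]; linarith
  have hz1 : 0 < ‖z‖ - 1 := by linarith
  have hzm : 0 < ‖z‖ ^ m := pow_pos (by linarith) m
  have h4 : ‖z + g.coeff m‖ * (‖z‖ - 1) ≤ H := by
    refine le_of_mul_le_mul_left ?_ hzm
    calc ‖z‖ ^ m * (‖z + g.coeff m‖ * (‖z‖ - 1))
        = (‖z‖ ^ m * ‖z + g.coeff m‖) * (‖z‖ - 1) := by ring
      _ ≤ (H * ∑ i ∈ Finset.range m, ‖z‖ ^ i) * (‖z‖ - 1) := by gcongr
      _ = H * ((∑ i ∈ Finset.range m, ‖z‖ ^ i) * (‖z‖ - 1)) := by ring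
      _ ≤ H * ‖z‖ ^ m := by gcongr
      _ = ‖z‖ ^ m * H := mul_comm _ _
  rw [le_div_iff₀ (by linarith)]
  have h5 : ‖z + g.coeff m‖ * (B / 2) ≤ ‖z + g.coeff m‖ * (‖z‖ - 1) := by
    gcongr; linarith
  linarith

theorem norm_multiset_sum_le_card_mul {s : Multiset ℂ} {c : ℝ} (h : ∀ z ∈ s, ‖z‖ ≤ c) :
    ‖s.sum‖ ≤ s.card * c := by
  induction s using Multiset.induction_on with
  | empty => simp
  | cons a s ih =>
    rw [Multiset.sum_cons, Multiset.card_cons]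
    push_cast
    have h1 := ih fun z hz => h z (Multiset.mem_cons_of_mem hz)
    have h2 := h a (Multiset.mem_cons_self _ _)
    linarith [norm_add_le a s.sum]

open Classical in
/-- If the second highest coefficient is large, there is exactly one large root: `J` large roots
would contribute about `-J` times that coefficient to the sum of the roots. -/
theorem card_large_roots_eq_one {m : ℕ} {g : ℤ[X]} (hg : g.Monic) (hdeg : g.natDegree = m + 1)
    {H B : ℝ} (hH : ∀ i, |(g.coeff i : ℝ)| ≤ H) (hB : 2 ≤ B)
    (hlarge : (m + 1) * (2 * H / B + B) < |(g.coeff m : ℝ)|) :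
    ((complexRoots g).filter fun z => B < ‖z‖).card = 1 := by
  have hH0 : 0 ≤ H := (abs_nonneg _).trans (hH 0)
  set big := (complexRoots g).filter fun z => B < ‖z‖ with hbig
  set small := (complexRoots g).filter fun z => ¬ B < ‖z‖ with hsmall
  set a : ℂ := ((g.coeff m : ℤ) : ℂ) with ha
  have hsplit : big + small = complexRoots g := Multiset.filter_add_not _ _
  have hcard : big.card + small.card = m + 1 := by
    rw [← Multiset.card_add, hsplit, card_complexRoots hg, hdeg]
  have hsum : big.sum + small.sum = -a := by
    rw [← Multiset.sum_add, hsplit]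
    have h1 := (IsAlgClosed.splits (g.map (Int.castRingHom ℂ))).nextCoeff_eq_neg_sum_roots_of_monic
      (hg.map _)
    rw [nextCoeff_of_natDegree_pos (by rw [hg.natDegree_map]; omega), hg.natDegree_map, hdeg,
      Nat.add_sub_cancel, coeff_map] at h1
    rw [ha, complexRoots, ← neg_neg (Multiset.sum _), ← h1]
    simp
  have h1 : ((big.map fun z => z + a).sum) = big.sum + big.card * a := by
    rw [Multiset.sum_map_add, Multiset.map_id', Multiset.map_const', Multiset.sum_replicate,
      nsmul_eq_mul]
  have h2 : ‖(big.map fun z => z + a).sum‖ ≤ big.card * (2 * H / B) := by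
    rw [← Multiset.card_map (fun z => z + a) big]
    refine norm_multiset_sum_le_card_mul fun w hw => ?_
    obtain ⟨z, hz, rfl⟩ := Multiset.mem_map.mp hw
    obtain ⟨hz1, hz2⟩ := Multiset.mem_filter.mp hz
    exact norm_add_nextCoeff_le hg hdeg hH hB ((mem_complexRoots hg).mp hz1) hz2
  have h3 : ‖small.sum‖ ≤ small.card * B :=
    norm_multiset_sum_le_card_mul fun z hz => not_lt.mp (Multiset.mem_filter.mp hz).2
  have h4 : ((big.card : ℂ) - 1) * a = (big.map fun z => z + a).sum + small.sum := by
    rw [h1]; linear_combination -hsum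
  have hc1 : (big.card : ℝ) ≤ m + 1 := by exact_mod_cast (by omega : big.card ≤ m + 1)
  have hc2 : (small.card : ℝ) ≤ m + 1 := by exact_mod_cast (by omega : small.card ≤ m + 1)
  have h5 : ‖((big.card : ℂ) - 1) * a‖ < |(g.coeff m : ℝ)| := by
    rw [h4]
    refine lt_of_le_of_lt ((norm_add_le _ _).trans (add_le_add h2 h3)) (lt_of_le_of_lt ?_ hlarge)
    rw [mul_add]
    gcongr
  rw [norm_mul, ha, Complex.norm_intCast] at h5
  by_contra hne
  have h6 : (1 : ℝ) ≤ ‖((big.card : ℂ) - 1)‖ := by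
    have h7 : ((big.card : ℂ) - 1) = (((big.card : ℤ) - 1 : ℤ) : ℂ) := by push_cast; rfl
    rw [h7, Complex.norm_intCast]
    have : (1 : ℤ) ≤ |(big.card : ℤ) - 1| := Int.one_le_abs (by omega)
    exact_mod_cast this
  nlinarith [abs_nonneg (g.coeff m : ℝ)]

/-- There are finitely many monic integer polynomials of bounded degree with bounded roots. -/
theorem finite_monic_roots_le (m : ℕ) (B : ℝ) :
    {v : ℤ[X] | v.Monic ∧ v.natDegree ≤ m ∧ ∀ z ∈ complexRoots v, ‖z‖ ≤ B}.Finite := by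
  obtain ⟨N, hN⟩ := exists_nat_ge (max B 1 ^ m * (m.choose (m / 2) : ℝ))
  refine Set.Finite.subset (s := ⋃ d ∈ Set.Iic m, ⋃ j ∈ Set.Iic m, dominantPolys d j N) ?_ ?_
  · exact (Set.finite_Iic m).biUnion fun d _ => (Set.finite_Iic m).biUnion fun j _ =>
      dominantPolys_finite d j N
  · rintro v ⟨hv, hd, hr⟩
    simp only [Set.mem_iUnion]
    refine ⟨v.natDegree, hd, numDominantRoots v, ?_, hv, rfl, ?_, rfl⟩
    · refine le_trans ?_ hd
      rw [numDominantRoots, ← card_complexRoots hv]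
      exact Multiset.card_le_card (Multiset.filter_le _ _)
    · rw [polyHeight_le_iff]
      intro i
      have h := (coeff_bdd_of_roots_le (Int.castRingHom ℂ) hv (IsAlgClosed.splits _) hd hr i).trans hN
      rw [coeff_map, eq_intCast, Complex.norm_intCast, ← Int.cast_abs, Int.abs_eq_natAbs] at h
      exact_mod_cast h

open Classical in
/-- A reducible polynomial with a single large root has a factor without large roots. -/
theorem exists_dvd_of_not_irreducible {g : ℤ[X]} {B : ℝ} (hg : g.Monic) (h1 : g ≠ 1)
    (hone : ((complexRoots g).filter fun z => B < ‖z‖).card = 1) (hred : ¬ Irreducible g) :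
    ∃ v : ℤ[X], v.Monic ∧ v.natDegree ≤ g.natDegree ∧ (∀ z ∈ complexRoots v, ‖z‖ ≤ B) ∧
      1 ≤ v.natDegree ∧ v ∣ g := by
  rw [hg.irreducible_iff_natDegree] at hred
  push Not at hred
  obtain ⟨u, v, hu, hv, huv, hu0, hv0⟩ := hred h1
  have hroots : complexRoots g = complexRoots u + complexRoots v := by
    rw [complexRoots, ← huv, Polynomial.map_mul, roots_mul]
    · rfl
    · exact mul_ne_zero (map_ne_zero_of_monic hu) (map_ne_zero_of_monic hv)
  rw [hroots, Multiset.filter_add, Multiset.card_add] at hone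
  have hdeg : g.natDegree = u.natDegree + v.natDegree := by rw [← huv, hu.natDegree_mul hv]
  have hnone : ∀ w : ℤ[X], ((complexRoots w).filter fun z => B < ‖z‖).card = 0 →
      ∀ z ∈ complexRoots w, ‖z‖ ≤ B := by
    intro w hw z hz
    rw [Multiset.card_eq_zero, Multiset.filter_eq_nil] at hw
    exact not_lt.mp (hw z hz)
  rcases Nat.eq_zero_or_pos ((complexRoots u).filter fun z => B < ‖z‖).card with h | h
  · exact ⟨u, hu, by omega, hnone u h, by omega, Dvd.intro _ huv⟩
  · exact ⟨v, hv, by omega, hnone v (by omega), by omega, Dvd.intro_left _ huv⟩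

/-! ### Irreducibility and dominant roots of `g (X ^ k)` -/

/-- Let `g` be irreducible over `K` with a root `x`, and let `k` be odd. If `x` had a `p`-th root in
`K(x)` for a prime `p ∣ k`, its norm would have `p`-th power `± g 0`; if there is no such element
of `K`, then `g (X ^ k)` is irreducible. -/
theorem irreducible_comp_X_pow_of_odd {K : Type*} [Field K] {g : K[X]} {k : ℕ} (hg : g.Monic)
    (hirr : Irreducible g) (hk : Odd k)
    (hpow : ∀ p : ℕ, p.Prime → p ∣ k → ∀ (t : K) (d : ℕ), t ^ p ≠ (-1) ^ d * g.coeff 0) :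
    Irreducible (g.comp (X ^ k)) := by
  refine irreducible_comp hg (monic_X_pow k) hirr ?_
  intro E _ _ x hx
  have hint : IsIntegral K x := by
    by_contra h
    rw [minpoly.eq_zero h] at hx
    exact hg.ne_zero hx.symm
  rw [Polynomial.map_pow, map_X]
  refine X_pow_sub_C_irreducible_of_odd hk fun p hp hpk b hb => ?_
  refine hpow p hp hpk (Algebra.norm K b) (IntermediateField.adjoin.powerBasis hint).dim ?_
  rw [← map_pow, hb, ← IntermediateField.adjoin.powerBasis_gen hint,
    Algebra.PowerBasis.norm_gen_eq_coeff_zero_minpoly, IntermediateField.adjoin.powerBasis_gen,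
    IntermediateField.minpoly_gen, hx]

theorem irreducible_expand {g : ℤ[X]} {k : ℕ} (hg : g.Monic) (hirr : Irreducible g) (hk : Odd k)
    (hpow : ∀ p : ℕ, p.Prime → p ∣ k → ∀ s : ℤ, s ^ p ≠ g.coeff 0) :
    Irreducible (expand ℤ k g) := by
  rw [(hg.expand hk.pos).irreducible_iff_irreducible_map_fraction_map (K := ℚ), map_expand,
    expand_eq_comp_X_pow]
  have hgQ := (hg.irreducible_iff_irreducible_map_fraction_map (K := ℚ)).mp hirr
  refine irreducible_comp_X_pow_of_odd (hg.map _) hgQ hk fun p hp hpk t d hd => ?_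
  rw [coeff_map, eq_intCast] at hd
  -- As `p` is odd, the sign can be moved into the `p`-th power.
  have hd2 : ((-1) ^ d * t) ^ p = (g.coeff 0 : ℚ) := by
    rw [mul_pow, hd, ← mul_assoc, ← pow_mul, ← pow_add]
    have : Even (d * p + d) := by
      obtain ⟨c, rfl⟩ := hk.of_dvd_nat hpk
      exact ⟨d * (c + 1), by ring⟩
    rw [this.neg_one_pow, one_mul]
  obtain ⟨s, hs⟩ := IsIntegrallyClosed.exists_algebraMap_eq_of_isIntegral_pow
    (R := ℤ) (K := ℚ) hp.pos (x := (-1) ^ d * t)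
    (by rw [hd2]; exact isIntegral_algebraMap (x := g.coeff 0))
  refine hpow p hp hpk s ?_
  rw [← hs] at hd2
  simp only [eq_intCast] at hd2
  exact_mod_cast hd2

open Classical in
/-- The dominant roots of `g (X ^ k)` are the `k`-th roots of the unique large root of `g`. -/
theorem numDominantRoots_expand {g : ℤ[X]} {k : ℕ} {B : ℝ} (hg : g.Monic) (hk : 0 < k)
    (hB : 0 ≤ B) (hone : ((complexRoots g).filter fun z => B < ‖z‖).card = 1)
    (hirr : Irreducible (expand ℤ k g)) : numDominantRoots (expand ℤ k g) = k := by
  have hfm : (expand ℤ k g).Monic := hg.expand hk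
  obtain ⟨α, hα⟩ := Multiset.card_eq_one.mp hone
  have hαmem : α ∈ (complexRoots g).filter fun z => B < ‖z‖ := by
    rw [hα]; exact Multiset.mem_singleton_self α
  obtain ⟨hα1, hα2⟩ := Multiset.mem_filter.mp hαmem
  have hα0 : α ≠ 0 := by
    rintro rfl
    rw [norm_zero] at hα2
    linarith
  have hmem : ∀ z, z ∈ complexRoots (expand ℤ k g) ↔ z ^ k ∈ complexRoots g := by
    intro z
    rw [mem_complexRoots hfm, mem_complexRoots hg, expand_aeval]
  have hdom : ∀ w ∈ complexRoots g, w = α ∨ ‖w‖ ≤ B := by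
    intro w hw
    by_cases h : B < ‖w‖
    · left
      have : w ∈ (complexRoots g).filter fun z => B < ‖z‖ := Multiset.mem_filter.mpr ⟨hw, h⟩
      rw [hα] at this
      exact Multiset.mem_singleton.mp this
    · exact Or.inr (not_lt.mp h)
  obtain ⟨β, hβ⟩ := IsAlgClosed.exists_pow_nat_eq α hk
  have hβmem : β ∈ complexRoots (expand ℤ k g) := by rw [hmem, hβ]; exact hα1
  have hhouse : polyHouse (expand ℤ k g) = ‖β‖₊ := by
    refine polyHouse_eq (fun z hz => ?_) hβmem rfl
    rw [← pow_le_pow_iff_left₀ zero_le zero_le hk.ne', ← nnnorm_pow, ← nnnorm_pow, hβ]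
    rcases hdom _ ((hmem z).mp hz) with h | h
    · rw [h]
    · exact_mod_cast h.trans hα2.le
  have hsep : (X ^ k - C α : ℂ[X]).Separable :=
    separable_X_pow_sub_C α (by exact_mod_cast hk.ne') hα0
  have hnd : (nthRoots k α).Nodup := nodup_roots hsep
  have hcard : (nthRoots k α).card = k := by
    rw [nthRoots, ← (IsAlgClosed.splits _).natDegree_eq_card_roots, natDegree_X_pow_sub_C]
  suffices h : (complexRoots (expand ℤ k g)).filter (fun z => ‖z‖₊ = polyHouse (expand ℤ k g))
      = nthRoots k α by
    rw [numDominantRoots, h, hcard]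
  refine (Multiset.Nodup.ext ((nodup_complexRoots hfm hirr).filter _) hnd).mpr fun z => ?_
  rw [Multiset.mem_filter, mem_nthRoots hk, hmem, hhouse,
    ← pow_left_inj₀ zero_le zero_le hk.ne', ← nnnorm_pow, ← nnnorm_pow, hβ]
  constructor
  · rintro ⟨h1, h2⟩
    rcases hdom _ h1 with h | h
    · exact h
    · have : ‖z ^ k‖ = ‖α‖ := congrArg NNReal.toReal h2
      linarith
  · intro h
    rw [h]
    exact ⟨hα1, rfl⟩

/-! ### Almost all polynomials have a single dominant root and stay irreducible -/

/-- The vectors of `m + 1` integers of absolute value at most `H`. -/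
noncomputable def intBox (m H : ℕ) : Finset (Fin (m + 1) → ℤ) :=
  Fintype.piFinset fun _ => Finset.Icc (-(H : ℤ)) H

theorem mem_intBox {m H : ℕ} {a : Fin (m + 1) → ℤ} :
    a ∈ intBox m H ↔ ∀ i, -(H : ℤ) ≤ a i ∧ a i ≤ H := by
  simp [intBox, Fintype.mem_piFinset]

theorem card_intBox (m H : ℕ) : (intBox m H).card = (2 * H + 1) ^ (m + 1) := by
  rw [intBox, Fintype.card_piFinset]
  simp only [Int.card_Icc, Finset.prod_const, Finset.card_univ, Fintype.card_fin]
  congr 1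
  omega

theorem card_intBox_filter_coord {m H : ℕ} (j : Fin (m + 1)) (T : Finset ℤ) :
    ((intBox m H).filter fun a => a j ∈ T).card ≤ T.card * (2 * H + 1) ^ m := by
  have hsub : ((intBox m H).filter fun a => a j ∈ T) ⊆
      Fintype.piFinset fun i => if i = j then T else Finset.Icc (-(H : ℤ)) H := by
    intro a ha
    obtain ⟨h1, h2⟩ := Finset.mem_filter.mp ha
    rw [Fintype.mem_piFinset]
    intro i
    split_ifs with h
    · exact h ▸ h2
    · exact Finset.mem_Icc.mpr (mem_intBox.mp h1 i)
  refine (Finset.card_le_card hsub).trans ?_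
  rw [Fintype.card_piFinset, Fin.prod_univ_succAbove _ j]
  simp only [if_true, Fin.succAbove_ne, if_false, Int.card_Icc, Finset.prod_const,
    Finset.card_univ, Fintype.card_fin]
  exact (congrArg (fun x => T.card * x ^ m) (by omega)).le

open Classical in
/-- The multiples of a fixed nonconstant polynomial are determined by their nonconstant
coefficients. -/
theorem card_intBox_filter_dvd {m H : ℕ} {v : ℤ[X]} (hd : 1 ≤ v.natDegree) :
    ((intBox m H).filter fun a => v ∣ monicPoly a).card ≤ (2 * H + 1) ^ m := by
  have hcard : (Fintype.piFinset fun _ : Fin m => Finset.Icc (-(H : ℤ)) H).card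
      = (2 * H + 1) ^ m := by
    rw [Fintype.card_piFinset]
    simp only [Int.card_Icc, Finset.prod_const, Finset.card_univ, Fintype.card_fin]
    congr 1
    omega
  rw [← hcard]
  refine Finset.card_le_card_of_injOn (fun a => Fin.tail a) ?_ ?_
  · intro a ha
    have h1 := mem_intBox.mp (Finset.mem_filter.mp ha).1
    rw [Finset.mem_coe, Fintype.mem_piFinset]
    exact fun i => Finset.mem_Icc.mpr (h1 i.succ)
  · intro a ha b hb hab
    have ha' := (Finset.mem_filter.mp ha).2
    have hb' := (Finset.mem_filter.mp hb).2
    have htail : ∀ i : Fin m, a i.succ = b i.succ := fun i => congrFun hab i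
    have hsub : monicPoly a - monicPoly b = C (a 0 - b 0) := by
      simp only [monicPoly, Fin.sum_univ_succ, htail, map_sub]
      simp
    have hdvd : v ∣ C (a 0 - b 0) := hsub ▸ dvd_sub ha' hb'
    have h0 : C (a 0 - b 0) = (0 : ℤ[X]) := by
      by_contra hne
      have := natDegree_le_of_dvd hdvd hne
      rw [natDegree_C] at this
      omega
    refine monicPoly_injective (sub_eq_zero.mp (hsub.trans h0))

theorem natAbs_le_sqrt_of_pow_le {s : ℤ} {p H : ℕ} (hp : 2 ≤ p) (h : (s ^ p).natAbs ≤ H) :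
    s.natAbs ≤ Nat.sqrt H := by
  rw [Nat.le_sqrt']
  rw [Int.natAbs_pow] at h
  rcases Nat.eq_zero_or_pos s.natAbs with h0 | h0
  · simp [h0]
  · exact (Nat.pow_le_pow_right h0 hp).trans h

/-- The integers that are `p`-th powers for some `p ≤ k`, of a number of modulus at most `√H`. -/
noncomputable def smallPowers (k H : ℕ) : Finset ℤ :=
  (Finset.range (k + 1) ×ˢ Finset.Icc (-(Nat.sqrt H : ℤ)) (Nat.sqrt H)).image fun x => x.2 ^ x.1

theorem card_smallPowers_le (k H : ℕ) :
    (smallPowers k H).card ≤ (k + 1) * (2 * Nat.sqrt H + 1) := by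
  refine Finset.card_image_le.trans ?_
  rw [Finset.card_product, Finset.card_range, Int.card_Icc]
  exact (congrArg (fun x => (k + 1) * x) (by omega)).le

theorem eventually_coeff_large (m : ℕ) {ε : ℝ} (hε : 0 < ε) :
    ∃ B : ℝ, 2 ≤ B ∧ ∃ H₁ : ℕ, ∀ H : ℕ, H₁ ≤ H → 1 ≤ H ∧
      (m + 1) * (2 * H / B + B) < ε * H := by
  -- `B` bounds the term with `H / B` by `ε * H / 4`; then large `H` does the same for the other.
  set B : ℝ := 2 + 8 * (m + 1) / ε with hB
  have hB0 : 0 < B := by positivity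
  have hB2 : 2 ≤ B := le_add_of_nonneg_right (by positivity)
  obtain ⟨N, hN⟩ := exists_nat_ge (4 * (m + 1) * B / ε)
  refine ⟨B, hB2, max N 1, fun H hH => ?_⟩
  have h1 : 1 ≤ H := (le_max_right _ _).trans hH
  refine ⟨h1, ?_⟩
  have hH1 : (1 : ℝ) ≤ H := by exact_mod_cast h1
  have hNH : (N : ℝ) ≤ H := by exact_mod_cast (le_max_left _ _).trans hH
  have h2 : 4 * (m + 1) * B ≤ ε * H := by
    have := hN.trans hNH
    rwa [div_le_iff₀ hε, mul_comm (H : ℝ)] at this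
  have h3 : (m + 1) * (2 * H / B) ≤ ε * H / 4 := by
    rw [mul_div_assoc', div_le_iff₀ hB0]
    have h4 : 8 * ((m : ℝ) + 1) ≤ ε * B := by
      have h5 : ε * (8 * (m + 1) / ε) = 8 * (m + 1) := mul_div_cancel₀ _ hε.ne'
      rw [hB]
      linarith
    nlinarith
  have h5 : 0 < ε * H := by positivity
  linarith

/-- Up to the vectors with small last coordinate, the multiples of finitely many polynomials and
the perfect powers as constant coefficient, every vector `a` gives an irreducible polynomial
`monicPoly a` in `X ^ k` with `k` dominant roots. -/
theorem le_irredCount_of_odd (m : ℕ) {k : ℕ} (hodd : Odd k) {ε : ℝ} (hε : 0 < ε) :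
    ∃ (C : ℝ) (H₁ : ℕ), ∀ H : ℕ, H₁ ≤ H →
      (2 * H + 1 : ℝ) ^ m * ((2 * H + 1) - (2 * (ε * H) + 1) - C
        - (k + 1) * (2 * Nat.sqrt H + 1)) ≤ irredCount ((m + 1) * k) k H := by
  classical
  have hk0 : 0 < k := hodd.pos
  obtain ⟨B, hB, H₁, hlarge⟩ := eventually_coeff_large m hε
  set F := (finite_monic_roots_le (m + 1) B).toFinset.filter fun v => 1 ≤ v.natDegree with hF
  refine ⟨F.card, H₁, fun H hH => ?_⟩
  obtain ⟨hH1, hlargeH⟩ := hlarge H hH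
  set T := Finset.Icc (-⌊ε * H⌋) ⌊ε * H⌋ with hT
  have hTcard : (T.card : ℝ) ≤ 2 * (ε * H) + 1 := by
    have h0 : (0 : ℤ) ≤ ⌊ε * H⌋ := Int.floor_nonneg.mpr (by positivity)
    have h : (T.card : ℤ) = 2 * ⌊ε * H⌋ + 1 := by
      rw [hT, Int.card_Icc, Int.toNat_of_nonneg (by omega)]; ring
    have h2 : (T.card : ℝ) = 2 * ⌊ε * H⌋ + 1 := by exact_mod_cast h
    rw [h2]
    linarith [Int.floor_le (ε * H)]
  -- The exceptional vectors: small last coordinate; a factor with all roots bounded by `B`; constant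
  -- coefficient a perfect power.
  set bad1 := (intBox m H).filter fun a => a (Fin.last m) ∈ T with hbad1
  set bad2 := F.biUnion fun v => (intBox m H).filter fun a => v ∣ monicPoly a with hbad2
  set bad3 := (intBox m H).filter fun a => a 0 ∈ smallPowers k H with hbad3
  set good := intBox m H \ (bad1 ∪ bad2 ∪ bad3) with hgood
  have hc1 : bad1.card ≤ T.card * (2 * H + 1) ^ m := card_intBox_filter_coord _ _
  have hc2 : bad2.card ≤ F.card * (2 * H + 1) ^ m := by
    refine Finset.card_biUnion_le_card_mul _ _ _ fun v hv => ?_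
    obtain ⟨-, h2⟩ := Finset.mem_filter.mp hv
    exact card_intBox_filter_dvd h2
  have hc3 : bad3.card ≤ (k + 1) * (2 * Nat.sqrt H + 1) * (2 * H + 1) ^ m :=
    (card_intBox_filter_coord _ _).trans (Nat.mul_le_mul_right _ (card_smallPowers_le k H))
  have hcount : (2 * H + 1) ^ (m + 1) ≤ good.card + (bad1.card + bad2.card + bad3.card) := by
    rw [← card_intBox]
    have h1 : (intBox m H).card - (bad1 ∪ bad2 ∪ bad3).card ≤ good.card :=
      Finset.le_card_sdiff _ _
    have h2 := (Finset.card_union_le (bad1 ∪ bad2) bad3).trans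
      (Nat.add_le_add_right (Finset.card_union_le bad1 bad2) _)
    omega
  have hgoodle : good.card ≤ irredCount ((m + 1) * k) k H := by
    rw [← Set.ncard_coe_finset, ← Set.ncard_image_of_injective _
      ((expand_injective hk0).comp (monicPoly_injective (n := m + 1)))]
    refine Set.ncard_le_ncard ?_ (irredCount_set_finite _ _ _)
    rintro _ ⟨a, ha, rfl⟩
    obtain ⟨habox, hanot⟩ := Finset.mem_sdiff.mp ha
    rw [Finset.mem_union, Finset.mem_union, not_or, not_or] at hanot
    obtain ⟨⟨ha1, ha2⟩, ha3⟩ := hanot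
    have hbox := mem_intBox.mp habox
    set g := monicPoly a with hg
    have hgm : g.Monic := monicPoly_monic a
    have hgd : g.natDegree = m + 1 := natDegree_monicPoly a
    have hgH : polyHeight g ≤ H :=
      polyHeight_monicPoly_le hH1 fun i => by have := hbox i; omega
    have hcoeff : ∀ i, |(g.coeff i : ℝ)| ≤ H := by
      intro i
      have := polyHeight_le_iff.mp hgH i
      rw [← Int.cast_abs, Int.abs_eq_natAbs]
      exact_mod_cast this
    have hone : ((complexRoots g).filter fun z => B < ‖z‖).card = 1 := by
      refine card_large_roots_eq_one hgm hgd hcoeff hB (hlargeH.trans ?_)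
      by_contra hle
      refine ha1 (Finset.mem_filter.mpr ⟨habox, ?_⟩)
      have hlast : g.coeff m = a (Fin.last m) := coeff_monicPoly a (Fin.last m)
      rw [hlast, not_lt, abs_le] at hle
      rw [hT, Finset.mem_Icc, neg_le, Int.le_floor, Int.le_floor]
      push_cast
      exact ⟨by linarith [hle.1], hle.2⟩
    have hirr : Irreducible g := by
      by_contra hred
      have hg1 : g ≠ 1 := by
        intro h
        rw [h, natDegree_one] at hgd
        omega
      obtain ⟨v, hv, hvd, hvr, hv1, hvg⟩ := exists_dvd_of_not_irreducible hgm hg1 hone hred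
      refine ha2 (Finset.mem_biUnion.mpr ⟨v, ?_, Finset.mem_filter.mpr ⟨habox, hvg⟩⟩)
      exact Finset.mem_filter.mpr ⟨(Set.Finite.mem_toFinset _).mpr ⟨hv, hgd ▸ hvd, hvr⟩, hv1⟩
    have hexp : Irreducible (expand ℤ k g) := by
      refine irreducible_expand hgm hirr hodd fun p hp hpk s hs => ha3 ?_
      have hc0 : g.coeff 0 = a 0 := coeff_monicPoly a 0
      rw [hc0] at hs
      refine Finset.mem_filter.mpr ⟨habox, Finset.mem_image.mpr ⟨(p, s), ?_, hs⟩⟩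
      have h0 := hbox 0
      have hsle : s.natAbs ≤ Nat.sqrt H :=
        natAbs_le_sqrt_of_pow_le hp.two_le (by rw [hs]; omega)
      have hpk' := Nat.le_of_dvd hk0 hpk
      rw [Finset.mem_product, Finset.mem_range, Finset.mem_Icc]
      exact ⟨by simp only; omega, by simp only; omega, by simp only; omega⟩
    refine ⟨⟨hgm.expand hk0, ?_, ?_, ?_⟩, hexp⟩
    · change (expand ℤ k g).natDegree = _
      rw [natDegree_expand, hgd]
    · rw [polyHeight_le_iff]
      intro i
      change ((expand ℤ k g).coeff i).natAbs ≤ H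
      rw [coeff_expand hk0]
      split_ifs
      · exact polyHeight_le_iff.mp hgH _
      · simp
    · exact numDominantRoots_expand hgm hk0 (by linarith) hone hexp
  have h1 : ((2 * H + 1 : ℕ) : ℝ) ^ (m + 1) ≤ irredCount ((m + 1) * k) k H +
      (T.card * ((2 * H + 1 : ℕ) : ℝ) ^ m + F.card * ((2 * H + 1 : ℕ) : ℝ) ^ m
        + (k + 1) * (2 * Nat.sqrt H + 1) * ((2 * H + 1 : ℕ) : ℝ) ^ m) := by
    exact_mod_cast hcount.trans (by gcongr)
  push_cast at h1
  have hpos : (0 : ℝ) < (2 * H + 1) ^ m := by positivity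
  have h2 := mul_le_mul_of_nonneg_right hTcard hpos.le
  rw [pow_succ] at h1
  nlinarith

theorem tendsto_lower_expression (m k : ℕ) (ε C : ℝ) :
    Tendsto (fun H : ℕ => (1 + (H : ℝ)⁻¹ / 2) ^ m *
      (1 - ε - C * (H : ℝ)⁻¹ / 2 - (k + 1) * (2 * (√(H : ℝ))⁻¹ + (H : ℝ)⁻¹) / 2))
      atTop (𝓝 (1 - ε)) := by
  have h1 : Tendsto (fun H : ℕ => (H : ℝ)⁻¹) atTop (𝓝 0) :=
    tendsto_inv_atTop_zero.comp tendsto_natCast_atTop_atTop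
  have h2 : Tendsto (fun H : ℕ => (√(H : ℝ))⁻¹) atTop (𝓝 0) :=
    tendsto_inv_atTop_zero.comp (Real.tendsto_sqrt_atTop.comp tendsto_natCast_atTop_atTop)
  have h3 := (((h1.div_const 2).const_add 1).pow m).mul
    ((((h1.const_mul C).div_const 2).const_sub (1 - ε)).sub
      ((((h2.const_mul 2).add h1).const_mul ((k : ℝ) + 1)).div_const 2))
  simpa using h3

theorem tendsto_irredCount_of_odd (m : ℕ) {k : ℕ} (hodd : Odd k) (hn : 2 ≤ (m + 1) * k) :
    Tendsto (fun H : ℕ => (irredCount ((m + 1) * k) k H : ℝ) / (2 * (H : ℝ)) ^ (m + 1))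
      atTop (𝓝 1) := by
  rw [tendsto_order]
  constructor
  · intro a ha
    obtain ⟨C, H₁, hlow⟩ := le_irredCount_of_odd m hodd (ε := (1 - a) / 2) (by linarith)
    have hlim := (tendsto_lower_expression m k ((1 - a) / 2) C).eventually
      (lt_mem_nhds (show a < 1 - (1 - a) / 2 by linarith))
    filter_upwards [hlim, eventually_ge_atTop H₁, eventually_ge_atTop 1] with H h1 h2 h3
    refine h1.trans_le ?_
    have hH : (0 : ℝ) < H := by exact_mod_cast h3
    rw [le_div_iff₀ (by positivity)]
    refine le_trans ?_ (hlow H h2)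
    have hs : (Nat.sqrt H : ℝ) ≤ √(H : ℝ) := Real.nat_sqrt_le_real_sqrt
    have hs2 : (√(H : ℝ))⁻¹ * H = √(H : ℝ) := by
      have : √(H : ℝ) ≠ 0 := (Real.sqrt_pos.mpr hH).ne'
      field_simp
      exact (Real.sq_sqrt hH.le).symm
    have heq : (1 + (H : ℝ)⁻¹ / 2) ^ m * (1 - (1 - a) / 2 - C * (H : ℝ)⁻¹ / 2
          - (k + 1) * (2 * (√(H : ℝ))⁻¹ + (H : ℝ)⁻¹) / 2) * (2 * (H : ℝ)) ^ (m + 1)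
        = (2 * H + 1) ^ m * (2 * H - 2 * ((1 - a) / 2 * H) - C
          - (k + 1) * (2 * √(H : ℝ) + 1)) := by
      have hi : (H : ℝ)⁻¹ * H = 1 := inv_mul_cancel₀ hH.ne'
      have e1 : (1 + (H : ℝ)⁻¹ / 2) * (2 * H) = 2 * H + 1 := by linear_combination hi
      have e2 : (1 - (1 - a) / 2 - C * (H : ℝ)⁻¹ / 2
            - (k + 1) * (2 * (√(H : ℝ))⁻¹ + (H : ℝ)⁻¹) / 2) * (2 * H)
          = 2 * H - 2 * ((1 - a) / 2 * H) - C - (k + 1) * (2 * √(H : ℝ) + 1) := by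
        linear_combination (-C - (k + 1)) * hi - 2 * (k + 1) * hs2
      rw [← e2, ← e1, mul_pow (1 + (H : ℝ)⁻¹ / 2) (2 * (H : ℝ)) m, pow_succ]
      ring
    rw [heq]
    refine mul_le_mul_of_nonneg_left ?_ (by positivity)
    have : ((k : ℝ) + 1) * (2 * Nat.sqrt H + 1) ≤ (k + 1) * (2 * √(H : ℝ) + 1) := by gcongr
    linarith
  · intro b hb
    have h1 : Tendsto (fun H : ℕ => (1 + (H : ℝ)⁻¹ / 2) ^ (m + 1)) atTop (𝓝 1) := by
      have h1 : Tendsto (fun H : ℕ => (H : ℝ)⁻¹) atTop (𝓝 0) :=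
        tendsto_inv_atTop_zero.comp tendsto_natCast_atTop_atTop
      simpa using ((h1.div_const 2).const_add 1).pow (m + 1)
    filter_upwards [h1.eventually (gt_mem_nhds hb), eventually_ge_atTop 1] with H h2 h3
    refine lt_of_le_of_lt ?_ h2
    have hH : (0 : ℝ) < H := by exact_mod_cast h3
    rw [div_le_iff₀ (by positivity), ← mul_pow]
    have e1 : (1 + (H : ℝ)⁻¹ / 2) * (2 * H) = ((2 * H + 1 : ℕ) : ℝ) := by
      push_cast
      field_simp
    rw [e1]
    exact_mod_cast irredCount_le_pow_of_odd hodd hn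

/-! ### The polynomials `X ^ m * g (X + q / X)` -/

/-- The polynomial `X ^ m * g (X + q / X)`, where `m` is the degree of `g`. -/
noncomputable def quadLift (q : ℤ) (g : ℤ[X]) : ℤ[X] :=
  ∑ j ∈ Finset.range (g.natDegree + 1),
    C (g.coeff j) * X ^ (g.natDegree - j) * (X ^ 2 + C q) ^ j

theorem aeval_quadLift {q : ℤ} {g : ℤ[X]} {z : ℂ} (hz : z ≠ 0) :
    aeval z (quadLift q g) = z ^ g.natDegree * aeval (z + q / z) g := by
  rw [quadLift, map_sum, aeval_eq_sum_range, Finset.mul_sum]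
  refine Finset.sum_congr rfl fun j hj => ?_
  have hj' : j ≤ g.natDegree := Nat.lt_succ_iff.mp (Finset.mem_range.mp hj)
  have h1 : z ^ 2 + q = z * (z + q / z) := by field_simp
  simp only [map_mul, map_add, map_pow, aeval_C, aeval_X, zsmul_eq_mul]
  simp only [algebraMap_int_eq, Int.coe_castRingHom]
  rw [h1, mul_pow]
  nth_rewrite 2 [← Nat.sub_add_cancel hj']
  rw [pow_add]
  ring

theorem degree_quadLift_lower_lt (q : ℤ) (g : ℤ[X]) :
    (∑ j ∈ Finset.range g.natDegree,
      C (g.coeff j) * X ^ (g.natDegree - j) * (X ^ 2 + C q) ^ j).degree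
      < ((2 * g.natDegree : ℕ) : WithBot ℕ) := by
  rw [degree_lt_iff_coeff_zero]
  intro d hd
  rw [finsetSum_coeff]
  refine Finset.sum_eq_zero fun j hj => coeff_eq_zero_of_natDegree_lt ?_
  have hj' := Finset.mem_range.mp hj
  have h1 : ((X ^ 2 + C q : ℤ[X]) ^ j).natDegree ≤ j * 2 :=
    natDegree_pow_le_of_le j (natDegree_X_pow_add_C.le)
  have h2 : (C (g.coeff j) * X ^ (g.natDegree - j) : ℤ[X]).natDegree ≤ g.natDegree - j :=
    natDegree_C_mul_X_pow_le _ _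
  have h3 := natDegree_mul_le_of_le h2 h1
  omega

theorem quadLift_eq {q : ℤ} {g : ℤ[X]} (hg : g.Monic) :
    quadLift q g = (X ^ 2 + C q) ^ g.natDegree + ∑ j ∈ Finset.range g.natDegree,
      C (g.coeff j) * X ^ (g.natDegree - j) * (X ^ 2 + C q) ^ j := by
  rw [quadLift, Finset.sum_range_succ, hg.coeff_natDegree]
  simp [add_comm]

theorem natDegree_X_sq_add_C_pow (q : ℤ) (m : ℕ) :
    ((X ^ 2 + C q : ℤ[X]) ^ m).natDegree = 2 * m := by
  rw [natDegree_pow, natDegree_X_pow_add_C, mul_comm]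

theorem quadLift_monic {q : ℤ} {g : ℤ[X]} (hg : g.Monic) : (quadLift q g).Monic := by
  have h1 : ((X ^ 2 + C q : ℤ[X]) ^ g.natDegree).Monic := (monic_X_pow_add_C q two_ne_zero).pow _
  rw [quadLift_eq hg]
  refine h1.add_of_left ?_
  rw [degree_eq_natDegree h1.ne_zero, natDegree_X_sq_add_C_pow]
  exact degree_quadLift_lower_lt q g

theorem natDegree_quadLift {q : ℤ} {g : ℤ[X]} (hg : g.Monic) :
    (quadLift q g).natDegree = 2 * g.natDegree := by
  have h1 : ((X ^ 2 + C q : ℤ[X]) ^ g.natDegree).Monic := (monic_X_pow_add_C q two_ne_zero).pow _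
  rw [quadLift_eq hg, natDegree_add_eq_left_of_degree_lt, natDegree_X_sq_add_C_pow]
  rw [degree_eq_natDegree h1.ne_zero, natDegree_X_sq_add_C_pow]
  exact degree_quadLift_lower_lt q g

theorem eval_zero_quadLift {q : ℤ} {g : ℤ[X]} (hg : g.Monic) :
    (quadLift q g).eval 0 = q ^ g.natDegree := by
  rw [quadLift_eq hg, eval_add, eval_finsetSum, Finset.sum_eq_zero]
  · simp
  · intro j hj
    have : g.natDegree - j ≠ 0 := by have := Finset.mem_range.mp hj; omega
    simp [this]

theorem eval_one_quadLift {q : ℤ} {g : ℤ[X]} :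
    (quadLift q g).eval 1 = g.eval (1 + q) := by
  rw [quadLift, eval_finsetSum, eval_eq_sum_range]
  simp

/-- Both `q` and `g` can be recovered from `X ^ m * g (X + q / X)`. -/
theorem quadLift_injective {m : ℕ} (hm : 1 ≤ m) {q q' : ℕ} (hq : 0 < q) {g g' : ℤ[X]}
    (hg : g.Monic) (hg' : g'.Monic) (hd : g.natDegree = m) (hd' : g'.natDegree = m)
    (h : quadLift q g = quadLift q' g') : q = q' ∧ g = g' := by
  have hqq : q = q' := by
    have h1 := congrArg (eval 0) h
    rw [eval_zero_quadLift hg, eval_zero_quadLift hg', hd, hd'] at h1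
    exact Nat.pow_left_injective (by omega : m ≠ 0) (by exact_mod_cast h1)
  subst hqq
  refine ⟨rfl, ?_⟩
  have hmap : g.map (Int.castRingHom ℂ) = g'.map (Int.castRingHom ℂ) := by
    refine Polynomial.funext fun t => ?_
    obtain ⟨z, hz⟩ := IsAlgClosed.exists_root (X ^ 2 - C t * X + C (q : ℂ)) (by
      have : (X ^ 2 - C t * X + C (q : ℂ)).degree = 2 := by compute_degree!
      rw [this]; decide)
    simp only [IsRoot.def, eval_add, eval_sub, eval_mul, eval_pow, eval_X, eval_C] at hz
    have hq0 : (q : ℂ) ≠ 0 := by exact_mod_cast hq.ne'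
    have hz0 : z ≠ 0 := by
      rintro rfl
      simp [hq0] at hz
    have ht : z + ((q : ℤ) : ℂ) / z = t := by
      field_simp
      push_cast
      linear_combination hz
    have h1 := congrArg (aeval z) h
    rw [aeval_quadLift hz0, aeval_quadLift hz0, ht, hd, hd'] at h1
    have h2 := mul_left_cancel₀ (pow_ne_zero m hz0) h1
    rw [eval_map, eval_map]
    exact h2
  exact map_injective _ (RingHom.injective_int _) hmap

/-- The solutions of `z + q / z = t` with `t` real, `t ^ 2 ≤ 4 * q`, have modulus `√q`. -/
theorem normSq_eq_of_add_div_eq {z : ℂ} {q t : ℝ} (hz : z ≠ 0) (h : z + q / z = t)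
    (ht : t ^ 2 ≤ 4 * q) : Complex.normSq z = q := by
  have h1 : z * z - t * z + q = 0 := by
    rw [← h]; field_simp; ring
  have hre := congrArg Complex.re h1
  have him := congrArg Complex.im h1
  simp only [Complex.add_re, Complex.sub_re, Complex.mul_re, Complex.ofReal_re, Complex.ofReal_im,
    Complex.zero_re, Complex.add_im, Complex.sub_im, Complex.mul_im, Complex.zero_im] at hre him
  rw [Complex.normSq_apply]
  rcases eq_or_ne z.im 0 with hy | hy
  · rw [hy] at hre ⊢
    have h2 : (z.re - t / 2) ^ 2 = 0 := le_antisymm (by nlinarith) (sq_nonneg _)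
    have h3 : z.re - t / 2 = 0 := by simpa using h2
    have h4 : t = 2 * z.re := by linarith
    rw [h4] at hre
    linarith
  · have h2 : z.im * (2 * z.re - t) = 0 := by linarith
    have h3 : t = 2 * z.re := by
      rcases mul_eq_zero.mp h2 with h | h
      · exact absurd h hy
      · linarith
    rw [h3] at hre
    linarith

theorem norm_root_quadLift {q : ℕ} (hq : 0 < q) {g : ℤ[X]} (hg : g.Monic)
    (hreal : ∀ z : ℂ, aeval z g = 0 → ∃ t : ℝ, z = t ∧ |t| ≤ 2 * √q) {z : ℂ}
    (hz : aeval z (quadLift q g) = 0) : ‖z‖ = √q := by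
  have hq0 : (0 : ℝ) < q := by exact_mod_cast hq
  have hz0 : z ≠ 0 := by
    rintro rfl
    rw [← coeff_zero_eq_aeval_zero', coeff_zero_eq_eval_zero, eval_zero_quadLift hg] at hz
    simp [hq.ne'] at hz
  rw [aeval_quadLift hz0] at hz
  obtain ⟨t, ht, htle⟩ := hreal _ ((mul_eq_zero.mp hz).resolve_left (pow_ne_zero _ hz0))
  have h1 : Complex.normSq z = q := by
    refine normSq_eq_of_add_div_eq hz0 (t := t) (by rw [← ht]; push_cast; rfl) ?_
    rw [← sq_abs, ← Real.sq_sqrt hq0.le]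
    calc |t| ^ 2 ≤ (2 * √q) ^ 2 := by gcongr
      _ = 4 * √q ^ 2 := by ring
  rw [Complex.norm_def, h1]

/-- If all roots of `g` are real and lie in `[-2√q, 2√q]`, all roots of the lift are dominant. -/
theorem quadLift_mem_dominantPolys {q m H : ℕ} (hq : 0 < q) (hm : 1 ≤ m) {g : ℤ[X]} (hg : g.Monic)
    (hd : g.natDegree = m)
    (hreal : ∀ z : ℂ, aeval z g = 0 → ∃ t : ℝ, z = t ∧ |t| ≤ 2 * √q) (hH : (4 * q) ^ m ≤ H) :
    quadLift q g ∈ dominantPolys (2 * m) (2 * m) H := by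
  have hmonic := quadLift_monic (q := q) hg
  have hdeg : (quadLift q g).natDegree = 2 * m := by rw [natDegree_quadLift hg, hd]
  have hroots : ∀ z ∈ complexRoots (quadLift q g), ‖z‖ = √q := fun z hz =>
    norm_root_quadLift hq hg hreal ((mem_complexRoots hmonic).mp hz)
  have hq1 : (1 : ℝ) ≤ √q := Real.one_le_sqrt.mpr (by exact_mod_cast hq)
  refine ⟨hmonic, hdeg, ?_, ?_⟩
  · rw [polyHeight_le_iff]
    intro i
    have h := coeff_le_of_roots_le (f := Int.castRingHom ℂ) i hmonic (IsAlgClosed.splits _)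
      fun z hz => (hroots z hz).le
    rw [coeff_map, eq_intCast, Complex.norm_intCast, hdeg, ← Int.cast_abs, Int.abs_eq_natAbs,
      Int.cast_natCast] at h
    have h2 : √(q : ℝ) ^ (2 * m - i) * (2 * m).choose i ≤ (4 * q) ^ m := by
      calc √(q : ℝ) ^ (2 * m - i) * (2 * m).choose i ≤ √(q : ℝ) ^ (2 * m) * 2 ^ (2 * m) := by
            gcongr
            · omega
            · exact_mod_cast Nat.choose_le_two_pow (2 * m) i
        _ = (4 * q) ^ m := by
            rw [pow_mul, pow_mul, Real.sq_sqrt (by positivity), ← mul_pow]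
            norm_num [mul_comm]
    have h3 : (((quadLift q g).coeff i).natAbs : ℝ) ≤ ((4 * q) ^ m : ℕ) := by
      push_cast
      exact h.trans h2
    exact (by exact_mod_cast h3 : ((quadLift q g).coeff i).natAbs ≤ (4 * q) ^ m).trans hH
  · obtain ⟨z, hz⟩ : ∃ z, z ∈ complexRoots (quadLift q g) := by
      rw [← Multiset.card_pos_iff_exists_mem, card_complexRoots hmonic, hdeg]
      omega
    have hnn : ∀ w ∈ complexRoots (quadLift q g), ‖w‖₊ = ‖z‖₊ := fun w hw =>
      NNReal.eq ((hroots w hw).trans (hroots z hz).symm)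
    rw [numDominantRoots, polyHouse_eq (fun w hw => (hnn w hw).le) hz rfl,
      Multiset.filter_eq_self.mpr hnn, card_complexRoots hmonic, hdeg]

/-- Under these congruences, the lift is congruent to `(X + 1) ^ (2 * m)` modulo `2`, and
its value at `1` is `2` modulo `4`; so it satisfies Eisenstein's criterion after the shift by `1`. -/
theorem irreducible_quadLift {q : ℤ} {g : ℤ[X]} (hg : g.Monic) (hd : 1 ≤ g.natDegree)
    (hq : q % 4 = 3) (h0 : g.coeff 0 % 4 = 2) (heven : ∀ j < g.natDegree, Even (g.coeff j)) :
    Irreducible (quadLift q g) := by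
  set f := quadLift q g with hf
  have hfm : f.Monic := quadLift_monic hg
  have hfd : f.natDegree = 2 * g.natDegree := natDegree_quadLift hg
  set φ := Int.castRingHom (ZMod 2) with hφ
  have hφ0 : ∀ a : ℤ, φ a = 0 ↔ (2 : ℤ) ∣ a := fun a => ZMod.intCast_zmod_eq_zero_iff_dvd a 2
  have hφq : φ q = 1 := by
    have h1 : φ (q - 1) = 0 := (hφ0 _).mpr (by omega)
    rwa [map_sub, map_one, sub_eq_zero] at h1
  have hfrob : (X + C 1 : (ZMod 2)[X]) ^ 2 = X ^ 2 + C 1 := by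
    rw [add_pow_char (p := 2) (X : (ZMod 2)[X]) (C 1), ← C_pow, one_pow]
  have hmod : f.map φ = (X + C 1) ^ (2 * g.natDegree) := by
    rw [hf, quadLift_eq hg, Polynomial.map_add, Polynomial.map_sum, Finset.sum_eq_zero, add_zero]
    · rw [Polynomial.map_pow, Polynomial.map_add, Polynomial.map_pow, map_X, map_C, hφq, pow_mul,
        hfrob]
    · intro j hj
      have : φ (g.coeff j) = 0 := (hφ0 _).mpr (heven j (Finset.mem_range.mp hj)).two_dvd
      rw [Polynomial.map_mul, Polynomial.map_mul, map_C, this, C_0, zero_mul, zero_mul]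
  have htaylor : (taylor 1 f).map φ = X ^ (2 * g.natDegree) := by
    rw [taylor_apply, Polynomial.map_comp, hmod]
    have : (1 : (ZMod 2)[X]) + 1 = 0 := by
      rw [← C_1, ← C_add]; exact (congrArg C (by decide : (1 : ZMod 2) + 1 = 0)).trans C_0
    simp [add_assoc, this]
  have htm : (taylor 1 f).Monic := by
    rw [taylor_apply]; exact hfm.comp_X_add_C 1
  have htd : (taylor 1 f).natDegree = 2 * g.natDegree := by rw [natDegree_taylor, hfd]
  have hirr : Irreducible (taylor 1 f) := by
    refine irreducible_of_eisenstein_criterion (P := Ideal.span {(2 : ℤ)})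
      ((Ideal.span_singleton_prime two_ne_zero).mpr Int.prime_two) ?_ ?_ ?_ ?_ htm.isPrimitive
    · rw [htm.leadingCoeff, Ideal.mem_span_singleton]; decide
    · intro i hi
      rw [degree_eq_natDegree htm.ne_zero, htd] at hi
      have hi' : i < 2 * g.natDegree := by exact_mod_cast hi
      rw [Ideal.mem_span_singleton, ← hφ0, ← coeff_map, htaylor, coeff_X_pow, if_neg hi'.ne]
    · rw [degree_eq_natDegree htm.ne_zero, htd]
      exact_mod_cast (by omega : 0 < 2 * g.natDegree)
    · rw [Ideal.span_singleton_pow, Ideal.mem_span_singleton, taylor_coeff_zero, hf,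
        eval_one_quadLift]
      -- The value at `1` is `g (1 + q)`, congruent to the constant coefficient of `g` modulo `1 + q`.
      have h1 := g.sub_dvd_eval_sub (1 + q) 0
      rw [sub_zero, ← coeff_zero_eq_eval_zero] at h1
      have h2 : (4 : ℤ) ∣ 1 + q := by omega
      have h3 := h2.trans h1
      norm_num
      omega
  exact (MulEquiv.irreducible_iff (taylorEquiv (1 : ℤ))).mp hirr

/-! ### Polynomials close to one with real roots -/

/-- A real polynomial of degree `m` that changes sign between consecutive points of
`y 0 < ⋯ < y m` has only real roots, all of them between `y 0` and `y m`. -/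
theorem root_real_of_sign_changes {p : ℝ[X]} {m : ℕ} (hp : p ≠ 0) (hd : p.natDegree = m)
    {y : ℕ → ℝ} (hy : StrictMono y) (hsign : ∀ i < m, p.eval (y i) * p.eval (y (i + 1)) < 0)
    {z : ℂ} (hz : aeval z p = 0) : ∃ t : ℝ, z = t ∧ y 0 ≤ t ∧ t ≤ y m := by
  have hex : ∀ i, ∃ t : ℝ, i < m → (y i < t ∧ t < y (i + 1) ∧ p.eval t = 0) := by
    intro i
    by_cases hi : i < m
    · have hlt : y i < y (i + 1) := hy (Nat.lt_succ_self i)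
      have hcont : ContinuousOn (fun x => p.eval x) (Set.Icc (y i) (y (i + 1))) :=
        p.continuous.continuousOn
      rcases mul_neg_iff.mp (hsign i hi) with ⟨h1, h2⟩ | ⟨h1, h2⟩
      · obtain ⟨t, ht, ht0⟩ := intermediate_value_Ioo' hlt.le hcont ⟨h2, h1⟩
        exact ⟨t, fun _ => ⟨ht.1, ht.2, ht0⟩⟩
      · obtain ⟨t, ht, ht0⟩ := intermediate_value_Ioo hlt.le hcont ⟨h1, h2⟩
        exact ⟨t, fun _ => ⟨ht.1, ht.2, ht0⟩⟩
    · exact ⟨0, fun h => absurd h hi⟩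
  choose t ht using hex
  set S := (Finset.range m).image fun i => (t i : ℂ) with hS
  have hinj : ∀ i j, i < j → j < m → t i < t j := by
    intro i j hij hj
    exact (ht i (hij.trans hj)).2.1.trans ((hy.monotone hij).trans_lt (ht j hj).1)
  have hcard : S.card = m := by
    rw [hS, Finset.card_image_of_injOn, Finset.card_range]
    intro i hi j hj hij
    have hij' : t i = t j := Complex.ofReal_injective hij
    rcases lt_trichotomy i j with h | h | h
    · exact absurd hij' (hinj i j h (by simpa using hj)).ne
    · exact h
    · exact absurd hij' (hinj j i h (by simpa using hi)).ne'
  set P := p.map (algebraMap ℝ ℂ) with hP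
  have hP0 : P ≠ 0 := (Polynomial.map_ne_zero_iff (algebraMap ℝ ℂ).injective).mpr hp
  have hsub : S ⊆ P.roots.toFinset := by
    intro w hw
    obtain ⟨i, hi, rfl⟩ := Finset.mem_image.mp hw
    rw [Multiset.mem_toFinset, mem_roots hP0, IsRoot.def, hP, eval_map, ← aeval_def,
      ← Complex.coe_algebraMap, aeval_algebraMap_apply, coe_aeval_eq_eval,
      (ht i (Finset.mem_range.mp hi)).2.2, map_zero]
  have heq : S = P.roots.toFinset := by
    refine Finset.eq_of_subset_of_card_le hsub ?_
    rw [hcard, ← hd, ← natDegree_map (p := p) (algebraMap ℝ ℂ)]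
    exact (Multiset.toFinset_card_le _).trans (card_roots' _)
  have hzmem : z ∈ S := by
    rw [heq, Multiset.mem_toFinset, mem_roots hP0, IsRoot.def, hP, eval_map, ← aeval_def, hz]
  obtain ⟨i, hi, rfl⟩ := Finset.mem_image.mp hzmem
  have hi' := Finset.mem_range.mp hi
  exact ⟨t i, rfl, (hy.monotone (Nat.zero_le i)).trans (ht i hi').1.le,
    (ht i hi').2.1.le.trans (hy.monotone hi')⟩

theorem mul_neg_of_abs_sub_lt {a b a' b' : ℝ} (ha : |a - a'| < |a'|) (hb : |b - b'| < |b'|)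
    (h : a' * b' < 0) : a * b < 0 := by
  rcases mul_neg_iff.mp h with ⟨h1, h2⟩ | ⟨h1, h2⟩
  · rw [abs_of_pos h1, abs_lt] at ha
    rw [abs_of_neg h2, abs_lt] at hb
    exact mul_neg_of_pos_of_neg (by linarith [ha.1]) (by linarith [hb.2])
  · rw [abs_of_neg h1, abs_lt] at ha
    rw [abs_of_pos h2, abs_lt] at hb
    exact mul_neg_of_neg_of_pos (by linarith [ha.2]) (by linarith [hb.1])

/-- The monic polynomial whose roots are the midpoints of the `m` intervals of equal length
subdividing `[-2, 2]`. -/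
noncomputable def midpointPoly (m : ℕ) : ℝ[X] :=
  ∏ j ∈ Finset.range m, (X - C (-2 + (4 * j + 2) / m : ℝ))

theorem midpointPoly_monic (m : ℕ) : (midpointPoly m).Monic :=
  monic_prod_of_monic _ _ fun _ _ => monic_X_sub_C _

theorem natDegree_midpointPoly (m : ℕ) : (midpointPoly m).natDegree = m := by
  rw [midpointPoly, natDegree_prod_of_monic _ _ fun _ _ => monic_X_sub_C _]
  simp only [natDegree_X_sub_C, Finset.sum_const, Finset.card_range, smul_eq_mul, mul_one]

theorem eval_midpointPoly (m i : ℕ) :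
    (midpointPoly m).eval (-2 + 4 * i / m : ℝ)
      = ∏ j ∈ Finset.range m, ((4 * ((i : ℝ) - j) - 2) / m) := by
  rw [midpointPoly, eval_prod]
  refine Finset.prod_congr rfl fun j _ => ?_
  simp only [eval_sub, eval_X, eval_C]
  ring

theorem eval_midpointPoly_ne_zero {m : ℕ} (hm : 1 ≤ m) (i : ℕ) :
    (midpointPoly m).eval (-2 + 4 * i / m : ℝ) ≠ 0 := by
  rw [eval_midpointPoly]
  refine Finset.prod_ne_zero_iff.mpr fun j _ => div_ne_zero (fun h => ?_) (by positivity)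
  have h1 : (4 * ((i : ℤ) - j) - 2) = 0 := by exact_mod_cast h
  omega

theorem eval_midpointPoly_mul_neg {m i : ℕ} (hi : i < m) :
    (midpointPoly m).eval (-2 + 4 * i / m : ℝ)
      * (midpointPoly m).eval (-2 + 4 * (i + 1 : ℕ) / m : ℝ) < 0 := by
  have hm : (0 : ℝ) < m := by exact_mod_cast (by omega : 0 < m)
  rw [eval_midpointPoly, eval_midpointPoly, ← Finset.prod_mul_distrib,
    ← Finset.mul_prod_erase _ _ (Finset.mem_range.mpr hi)]
  refine mul_neg_of_neg_of_pos ?_ (Finset.prod_pos fun j hj => ?_)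
  · rw [div_mul_div_comm]
    refine div_neg_of_neg_of_pos ?_ (by positivity)
    push_cast
    nlinarith
  · have hne := Finset.ne_of_mem_erase hj
    rw [div_mul_div_comm]
    refine div_pos ?_ (by positivity)
    rcases lt_or_gt_of_ne hne with h | h
    · have h1 : (1 : ℝ) ≤ (i : ℝ) - j := by
        have : (j : ℝ) + 1 ≤ i := by exact_mod_cast h
        linarith
      push_cast
      nlinarith
    · have h1 : (i : ℝ) - j ≤ -1 := by
        have : (i : ℝ) + 1 ≤ j := by exact_mod_cast h
        linarith
      push_cast
      nlinarith

theorem aeval_monicPoly {m : ℕ} (b : Fin m → ℤ) {A : Type*} [CommRing A] (x : A) :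
    aeval x (monicPoly b) = x ^ m + ∑ j : Fin m, (b j : A) * x ^ (j : ℕ) := by
  simp [monicPoly]

/-- Integer polynomials whose coefficients are close to those of the rescaling by `s` of a fixed
polynomial have all their roots real and in `[-2s, 2s]`. -/
theorem exists_box_real_roots {m : ℕ} (hm : 1 ≤ m) :
    ∃ (β : Fin m → ℝ) (ε : ℝ), 0 < ε ∧ ∀ s : ℝ, 0 < s → ∀ b : Fin m → ℤ,
      (∀ j, |(b j : ℝ) - β j * s ^ (m - j : ℕ)| ≤ ε * s ^ (m - j : ℕ)) →
      ∀ z : ℂ, aeval z (monicPoly b) = 0 → ∃ t : ℝ, z = t ∧ |t| ≤ 2 * s := by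
  have hm0 : (0 : ℝ) < m := by exact_mod_cast hm
  set h := midpointPoly m with hh
  set y : ℕ → ℝ := fun i => -2 + 4 * i / m with hy
  have hyabs : ∀ i ≤ m, |y i| ≤ 2 := by
    intro i hi
    have h1 : (i : ℝ) / m ≤ 1 := by rw [div_le_one hm0]; exact_mod_cast hi
    have h2 : (0 : ℝ) ≤ (i : ℝ) / m := by positivity
    have h3 : y i = -2 + 4 * ((i : ℝ) / m) := by rw [hy]; ring
    rw [h3, abs_le]
    constructor <;> linarith
  obtain ⟨δ, hδ, hδle⟩ : ∃ δ : ℝ, 0 < δ ∧ ∀ i ≤ m, δ ≤ |h.eval (y i)| := by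
    obtain ⟨i₀, -, hi₀⟩ := Finset.exists_min_image (Finset.range (m + 1))
      (fun i => |h.eval (y i)|) ⟨0, by simp⟩
    exact ⟨_, abs_pos.mpr (eval_midpointPoly_ne_zero hm i₀),
      fun i hi => hi₀ i (Finset.mem_range.mpr (by omega))⟩
  have hheval : ∀ x : ℝ, h.eval x = x ^ m + ∑ j : Fin m, h.coeff j * x ^ (j : ℕ) := by
    intro x
    rw [eval_eq_sum_range, hh, natDegree_midpointPoly, Finset.sum_range_succ]
    have h1 : (midpointPoly m).coeff m = 1 := by
      have := (midpointPoly_monic m).coeff_natDegree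
      rwa [natDegree_midpointPoly] at this
    rw [h1, one_mul, add_comm, Fin.sum_univ_eq_sum_range fun j => (midpointPoly m).coeff j * x ^ j]
  refine ⟨fun j => h.coeff j, δ / (2 * (m * 2 ^ m)), by positivity, fun s hs b hb z hz => ?_⟩
  set ε := δ / (2 * (m * 2 ^ m)) with hε
  have hε0 : 0 < ε := by positivity
  set p := (monicPoly b).map (algebraMap ℤ ℝ) with hp
  have hpm : p.Monic := (monicPoly_monic b).map _
  have hpd : p.natDegree = m := by rw [hp, (monicPoly_monic b).natDegree_map, natDegree_monicPoly]
  have hpeval : ∀ x : ℝ, p.eval x = x ^ m + ∑ j : Fin m, (b j : ℝ) * x ^ (j : ℕ) := by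
    intro x
    rw [hp, eval_map, ← aeval_def, aeval_monicPoly]
  have hclose : ∀ i ≤ m, |p.eval (s * y i) - s ^ m * h.eval (y i)| < |s ^ m * h.eval (y i)| := by
    intro i hi
    have h1 : p.eval (s * y i) - s ^ m * h.eval (y i)
        = ∑ j : Fin m, ((b j : ℝ) - h.coeff j * s ^ (m - j : ℕ)) * (s * y i) ^ (j : ℕ) := by
      rw [hpeval, hheval, mul_add (s ^ m), mul_pow s (y i) m, add_sub_add_left_eq_sub, Finset.mul_sum,
        ← Finset.sum_sub_distrib]
      refine Finset.sum_congr rfl fun j _ => ?_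
      have h2 : s ^ m = s ^ (m - j : ℕ) * s ^ (j : ℕ) := by
        rw [← pow_add, Nat.sub_add_cancel j.2.le]
      rw [h2]
      generalize y i = w
      ring
    have h3 : ∀ j : Fin m, |((b j : ℝ) - h.coeff j * s ^ (m - j : ℕ)) * (s * y i) ^ (j : ℕ)|
        ≤ ε * s ^ m * 2 ^ m := by
      intro j
      have h2 : s ^ m = s ^ (m - j : ℕ) * s ^ (j : ℕ) := by
        rw [← pow_add, Nat.sub_add_cancel j.2.le]
      rw [abs_mul, mul_pow, abs_mul, abs_of_pos (pow_pos hs _), abs_pow]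
      calc |(b j : ℝ) - h.coeff j * s ^ (m - j : ℕ)| * (s ^ (j : ℕ) * |y i| ^ (j : ℕ))
          ≤ (ε * s ^ (m - j : ℕ)) * (s ^ (j : ℕ) * 2 ^ m) := by
            refine mul_le_mul (hb j) ?_ (by positivity) (by positivity)
            refine mul_le_mul_of_nonneg_left ?_ (by positivity)
            exact (pow_le_pow_left₀ (abs_nonneg _) (hyabs i hi) _).trans
              (pow_le_pow_right₀ one_le_two j.2.le)
        _ = ε * s ^ m * 2 ^ m := by rw [h2]; ring
    calc |p.eval (s * y i) - s ^ m * h.eval (y i)| ≤ ∑ _j : Fin m, ε * s ^ m * 2 ^ m := by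
          rw [h1]
          exact (Finset.abs_sum_le_sum_abs _ _).trans (Finset.sum_le_sum fun j _ => h3 j)
      _ = s ^ m * (δ / 2) := by
          rw [Finset.sum_const, Finset.card_univ, Fintype.card_fin, nsmul_eq_mul, hε]
          field_simp
      _ < s ^ m * δ := by
          refine mul_lt_mul_of_pos_left (by linarith) (by positivity)
      _ ≤ |s ^ m * h.eval (y i)| := by
          rw [abs_mul, abs_of_pos (pow_pos hs m)]
          exact mul_le_mul_of_nonneg_left (hδle i hi) (by positivity)
  have hmono : StrictMono fun i => s * y i := by
    refine strictMono_nat_of_lt_succ fun i => mul_lt_mul_of_pos_left ?_ hs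
    have : (4 * (i : ℝ)) / m < 4 * ((i + 1 : ℕ) : ℝ) / m := by
      refine div_lt_div_of_pos_right ?_ hm0
      push_cast
      linarith
    simp only [hy]
    linarith
  have hz' : aeval z p = 0 := by rw [hp, aeval_map_algebraMap, hz]
  obtain ⟨t, ht, h1, h2⟩ := root_real_of_sign_changes hpm.ne_zero hpd hmono (fun i hi => by
    refine mul_neg_of_abs_sub_lt (hclose i hi.le) (hclose (i + 1) hi) ?_
    have := eval_midpointPoly_mul_neg hi
    have hsm : 0 < s ^ m := pow_pos hs m
    calc s ^ m * h.eval (y i) * (s ^ m * h.eval (y (i + 1)))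
        = (s ^ m * s ^ m) * (h.eval (y i) * h.eval (y (i + 1))) := by ring
      _ < 0 := mul_neg_of_pos_of_neg (by positivity) this) hz'
  refine ⟨t, ht, abs_le.mpr ⟨?_, ?_⟩⟩
  · nlinarith [(abs_le.mp (hyabs 0 (Nat.zero_le m))).1]
  · nlinarith [(abs_le.mp (hyabs m le_rfl)).2]

/-! ### Counting the polynomials with all roots on a circle -/

/-- With `q` in `[4N, 8N]` and the coefficient of `X ^ j` of `g` ranging over an interval of length
proportional to `N ^ ((m - j) / 2)`, one obtains this many irreducible lifts. -/
theorem exists_le_irredCount {m : ℕ} (hm : 1 ≤ m) :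
    ∃ c : ℝ, 0 < c ∧ ∃ N₀ : ℕ, ∀ N H : ℕ, N₀ ≤ N → (32 * N) ^ m ≤ H →
      c * (N : ℝ) * ∏ j : Fin m, √(N : ℝ) ^ (m - j : ℕ) ≤ irredCount (2 * m) (2 * m) H := by
  classical
  obtain ⟨β, ε, hε, hbox⟩ := exists_box_real_roots hm
  obtain ⟨M, hM⟩ := exists_nat_ge (12 / ε)
  refine ⟨(ε / 8) ^ m, by positivity, max (M ^ 2) 1, fun N H hN hH => ?_⟩
  have hN1 : 1 ≤ N := (le_max_right _ _).trans hN
  have hNM : M ^ 2 ≤ N := (le_max_left _ _).trans hN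
  have hR1 : (1 : ℝ) ≤ √(N : ℝ) := Real.one_le_sqrt.mpr (by exact_mod_cast hN1)
  have hR2 : 12 ≤ ε * √(N : ℝ) := by
    have h1 : (M : ℝ) ≤ √(N : ℝ) := Real.le_sqrt_of_sq_le (by exact_mod_cast hNM)
    have h2 := hM.trans h1
    rwa [div_le_iff₀ hε, mul_comm] at h2
  -- The rounding to the residue classes modulo `4` costs at most `6`, absorbed by `ε * √N ≥ 12`.
  set D : Fin m → ℕ := fun j => ⌊ε / 8 * √(N : ℝ) ^ (m - j : ℕ)⌋₊ with hD
  set q : ℕ → ℕ := fun u => 4 * (N + u) + 3 with hq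
  set b : ℕ → (Fin m → ℕ) → Fin m → ℤ := fun u d j =>
    4 * (⌊β j * √(q u : ℝ) ^ (m - j : ℕ) / 4⌋ + d j) + (if (j : ℕ) = 0 then 2 else 0) with hb
  set I := Finset.range N ×ˢ Fintype.piFinset fun j : Fin m => Finset.range (D j + 1) with hI
  have hcard : I.card = N * ∏ j : Fin m, (D j + 1) := by
    rw [hI, Finset.card_product, Finset.card_range, Fintype.card_piFinset]
    simp
  have hle : I.card ≤ irredCount (2 * m) (2 * m) H := by
    have hinj : Set.InjOn (fun x : ℕ × (Fin m → ℕ) => quadLift (q x.1) (monicPoly (b x.1 x.2)))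
        (I : Set (ℕ × (Fin m → ℕ))) := by
      rintro ⟨u, d⟩ - ⟨u', d'⟩ - h
      obtain ⟨h1, h2⟩ := quadLift_injective hm (by simp only [hq]; omega) (monicPoly_monic _)
        (monicPoly_monic _) (natDegree_monicPoly _) (natDegree_monicPoly _) h
      have hu : u = u' := by simp only [hq] at h1; omega
      subst hu
      have h3 := monicPoly_injective h2
      refine Prod.ext rfl (funext fun j => ?_)
      have h4 := congrFun h3 j
      simp only [hb] at h4
      change d j = d' j
      omega
    rw [← Set.ncard_coe_finset, ← hinj.ncard_image]
    refine Set.ncard_le_ncard ?_ (irredCount_set_finite _ _ _)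
    rintro _ ⟨⟨u, d⟩, hud, rfl⟩
    obtain ⟨hu, hd⟩ := Finset.mem_product.mp hud
    have hu' : u < N := Finset.mem_range.mp hu
    have hd' : ∀ j, d j ≤ D j := fun j =>
      Nat.lt_succ_iff.mp (Finset.mem_range.mp (Fintype.mem_piFinset.mp hd j))
    have hq0 : 0 < q u := by simp only [hq]; omega
    have hNq : √(N : ℝ) ≤ √(q u : ℝ) := by
      refine Real.sqrt_le_sqrt ?_
      exact_mod_cast (by simp only [hq]; omega : N ≤ q u)
    set g := monicPoly (b u d) with hg
    have hgm : g.Monic := monicPoly_monic _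
    have hgd : g.natDegree = m := natDegree_monicPoly _
    have hreal : ∀ z : ℂ, aeval z g = 0 → ∃ t : ℝ, z = t ∧ |t| ≤ 2 * √(q u : ℝ) := by
      refine hbox _ (Real.sqrt_pos.mpr (by exact_mod_cast hq0)) _ fun j => ?_
      have hexp : 1 ≤ m - (j : ℕ) := by have := j.2; omega
      have hpow : √(N : ℝ) ^ (m - j : ℕ) ≤ √(q u : ℝ) ^ (m - j : ℕ) := by gcongr
      have h12 : 12 ≤ ε * √(N : ℝ) ^ (m - j : ℕ) :=
        hR2.trans (by gcongr; exact le_self_pow₀ hR1 (by omega))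
      have hdD : (d j : ℝ) ≤ ε / 8 * √(N : ℝ) ^ (m - j : ℕ) := by
        refine le_trans (by exact_mod_cast hd' j) (Nat.floor_le (by positivity))
      -- The difference lies between `-4` and `4 * D j + 2`.
      have hfl1 := Int.floor_le (β j * √(q u : ℝ) ^ (m - j : ℕ) / 4)
      have hfl2 := Int.lt_floor_add_one (β j * √(q u : ℝ) ^ (m - j : ℕ) / 4)
      have hd0 : (0 : ℝ) ≤ d j := Nat.cast_nonneg _
      have hbj : (b u d j : ℝ) = 4 * (⌊β j * √(q u : ℝ) ^ (m - j : ℕ) / 4⌋ + d j)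
          + (if (j : ℕ) = 0 then 2 else 0) := by
        simp only [hb]
        split_ifs <;> push_cast <;> rfl
      have hite : (0 : ℝ) ≤ (if (j : ℕ) = 0 then 2 else 0) ∧
          (if (j : ℕ) = 0 then 2 else 0) ≤ (2 : ℝ) := by
        split_ifs <;> norm_num
      have hεpow := mul_le_mul_of_nonneg_left hpow hε.le
      rw [hbj, abs_le]
      constructor <;> linarith [hite.1, hite.2]
    refine ⟨quadLift_mem_dominantPolys hq0 hm hgm hgd hreal ?_, ?_⟩
    · refine le_trans (Nat.pow_le_pow_left ?_ m) hH
      simp only [hq]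
      omega
    · have hcoeff : ∀ j : Fin m, g.coeff j = b u d j := coeff_monicPoly _
      refine irreducible_quadLift hgm (hm.trans hgd.ge) ?_ ?_ ?_
      · have hq4 : q u % 4 = 3 := by simp only [hq]; omega
        change ((q u : ℕ) : ℤ) % 4 = 3
        omega
      · have h0 := hcoeff ⟨0, hm⟩
        rw [show g.coeff 0 = _ from h0]
        simp only [hb, if_true]
        omega
      · intro j hj
        have h1 := hcoeff ⟨j, hgd ▸ hj⟩
        rw [show g.coeff j = _ from h1, Int.even_iff]
        simp only [hb]
        split_ifs <;> omega
  have hfin : (ε / 8) ^ m * (N : ℝ) * ∏ j : Fin m, √(N : ℝ) ^ (m - j : ℕ) ≤ (I.card : ℝ) := by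
    rw [hcard]
    push_cast
    calc (ε / 8) ^ m * (N : ℝ) * ∏ j : Fin m, √(N : ℝ) ^ (m - j : ℕ)
        = N * ∏ j : Fin m, (ε / 8 * √(N : ℝ) ^ (m - j : ℕ)) := by
          rw [Finset.prod_mul_distrib, Finset.prod_const, Finset.card_univ, Fintype.card_fin]
          ring
      _ ≤ N * ∏ j : Fin m, ((D j : ℝ) + 1) := by
          refine mul_le_mul_of_nonneg_left ?_ (by positivity)
          refine Finset.prod_le_prod (fun _ _ => by positivity) fun j _ => ?_
          exact (Nat.lt_floor_add_one _).le
  exact hfin.trans (by exact_mod_cast hle)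

theorem prod_sqrt_pow (m : ℕ) {x : ℝ} (hx : 0 ≤ x) :
    ∏ j : Fin m, √x ^ (m - j : ℕ) = x ^ ((m : ℝ) * (m + 1) / 4) := by
  have hsum : ∑ j : Fin m, (m - j : ℕ) = ∑ j ∈ Finset.range (m + 1), j := by
    rw [Fin.sum_univ_eq_sum_range fun j => m - j, Finset.sum_range_succ',
      ← Finset.sum_range_reflect, add_zero]
    refine Finset.sum_congr rfl fun j hj => ?_
    have := Finset.mem_range.mp hj
    omega
  rw [Finset.prod_pow_eq_pow_sum, hsum, Real.sqrt_eq_rpow, ← Real.rpow_natCast,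
    ← Real.rpow_mul hx]
  congr 1
  have h := Finset.sum_range_id_mul_two (m + 1)
  have h' : ((∑ j ∈ Finset.range (m + 1), j : ℕ) : ℝ) * 2 = (m + 1) * m := by
    exact_mod_cast h
  linarith

theorem rpow_le_irredCount {m : ℕ} (hm : 1 ≤ m) :
    ∃ c : ℝ, 0 < c ∧ ∃ H₀ : ℕ, ∀ H : ℕ, H₀ ≤ H →
      c * (H : ℝ) ^ ((m : ℝ) / 4 + 1 / m + 1 / 4) ≤ irredCount (2 * m) (2 * m) H := by
  obtain ⟨c, hc, N₀, hN₀⟩ := exists_le_irredCount hm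
  have hm0 : (m : ℝ) ≠ 0 := by positivity
  set e : ℝ := 1 + (m : ℝ) * (m + 1) / 4 with he
  refine ⟨c * (1 / 64) ^ e, by positivity, (64 * (N₀ + 1)) ^ m, fun H hH => ?_⟩
  -- With `x = H ^ (1 / m)`, the choice `N = ⌊x / 32⌋` gives `(32 * N) ^ m ≤ H` and `x / 64 ≤ N`.
  set x : ℝ := (H : ℝ) ^ (1 / (m : ℝ)) with hx
  have hxm : x ^ m = H := by
    rw [hx, ← Real.rpow_natCast, ← Real.rpow_mul (by positivity), one_div_mul_cancel hm0,
      Real.rpow_one]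
  have hx0 : 0 ≤ x := by positivity
  have hx1 : 64 * ((N₀ : ℝ) + 1) ≤ x := by
    refine le_of_pow_le_pow_left₀ (by omega : m ≠ 0) hx0 ?_
    rw [hxm]
    exact_mod_cast hH
  set N := ⌊x / 32⌋₊ with hN
  have hNle : (N : ℝ) ≤ x / 32 := Nat.floor_le (by positivity)
  have hNge : x / 64 ≤ N := by
    have := Nat.lt_floor_add_one (x / 32)
    have h0 : (0 : ℝ) ≤ N₀ := Nat.cast_nonneg _
    linarith
  have h1 : N₀ ≤ N := Nat.le_floor (by linarith [(Nat.cast_nonneg N₀ : (0 : ℝ) ≤ N₀)])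
  have h2 : (32 * N) ^ m ≤ H := by
    have : (32 * (N : ℝ)) ^ m ≤ H := by
      rw [← hxm]
      gcongr
      linarith
    exact_mod_cast this
  refine le_trans ?_ (hN₀ N H h1 h2)
  have hNpos : (0 : ℝ) < N := by
    have : (0 : ℝ) ≤ N₀ := Nat.cast_nonneg _
    linarith
  have h3 : (N : ℝ) ^ e = N * (N : ℝ) ^ ((m : ℝ) * (m + 1) / 4) := by
    rw [he, Real.rpow_add hNpos, Real.rpow_one]
  rw [prod_sqrt_pow m hNpos.le, mul_assoc, mul_assoc, ← h3]
  refine mul_le_mul_of_nonneg_left ?_ hc.le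
  have h4 : (H : ℝ) ^ ((m : ℝ) / 4 + 1 / m + 1 / 4) = x ^ e := by
    rw [hx, ← Real.rpow_mul (by positivity)]
    congr 1
    rw [he]
    field_simp
    ring
  rw [h4, ← Real.mul_rpow (by norm_num) hx0]
  exact Real.rpow_le_rpow (by positivity) (by linarith) (by positivity)

theorem theorem1p2 (n : ℕ) (hn : 2 ≤ n) :
    (∀ k : ℕ, Odd k → 1 ≤ k → k ≤ n →
      (k ∣ n → Tendsto (fun H : ℕ => (irredCount n k H : ℝ) / (2 * (H : ℝ)) ^ ((n : ℝ) / (k : ℝ)))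
        atTop (𝓝 1)) ∧
      (¬ k ∣ n → ∀ H : ℕ, 1 ≤ H → irredCount n k H = 0)) ∧
    (∀ k : ℕ, 1 ≤ k → k ≤ n →
      ∃ C : ℝ, 0 < C ∧ ∀ H : ℕ, 1 ≤ H →
        (irredCount n k H : ℝ) ≤ C * (H : ℝ) ^ ((n : ℝ) - ((k : ℝ) - 1) / 2)) ∧
    (Even n →
      ∃ c : ℝ, 0 < c ∧ ∃ H₀ : ℕ, ∀ H : ℕ, H₀ ≤ H →
        c * (H : ℝ) ^ ((n : ℝ) / 8 + 2 / (n : ℝ) + 1 / 4) ≤ (irredCount n n H : ℝ)) := by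
  refine ⟨fun k hodd hk hkn => ⟨?_, fun hdvd H _ => ?_⟩, fun k hk hkn => irredCount_le_rpow hk hkn,
    fun heven => ?_⟩
  · rintro ⟨m, rfl⟩
    rw [mul_comm] at hn ⊢
    obtain ⟨m, rfl⟩ : ∃ m', m = m' + 1 := Nat.exists_eq_succ_of_ne_zero (by rintro rfl; omega)
    have hk0 : (k : ℝ) ≠ 0 := by positivity
    have hexp : (((m + 1) * k : ℕ) : ℝ) / k = ((m + 1 : ℕ) : ℝ) := by
      push_cast
      field_simp
    rw [hexp]
    simp_rw [Real.rpow_natCast]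
    exact tendsto_irredCount_of_odd m hodd hn
  · rw [irredCount, Set.ncard_eq_zero (irredCount_set_finite n k H),
      Set.eq_empty_iff_forall_notMem]
    rintro f ⟨⟨hf, hd, -, hkf⟩, hirr⟩
    have h1 := (numDominantRoots_dvd hf hirr (hd ▸ hn) (hkf ▸ hodd)).1
    rw [hkf, hd] at h1
    exact hdvd h1
  · obtain ⟨m, hm⟩ := heven
    obtain rfl : n = 2 * m := by omega
    obtain ⟨c, hc, H₀, h⟩ := rpow_le_irredCount (m := m) (by omega)
    refine ⟨c, hc, H₀, fun H hH => ?_⟩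
    have hm0 : (m : ℝ) ≠ 0 := by
      have : m ≠ 0 := by omega
      exact_mod_cast this
    have hexp : ((2 * m : ℕ) : ℝ) / 8 + 2 / ((2 * m : ℕ) : ℝ) + 1 / 4
        = (m : ℝ) / 4 + 1 / m + 1 / 4 := by
      push_cast
      field_simp
      ring
    rw [hexp]
    exact h H hH
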